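/- Let $F$ be a local field of characteristic zero, $\psi$ a nontrivial continuous unitary character of $(F,+)$, and $u,J\in F^\times$. Let $E=F[\mathbf i]$ with $\mathbf i^2=u$ (so $E$ is a possibly split quadratic extension of $F$), with involution $x\mapsto\bar x$, trace $\mathrm{Tr}$ and norm $\mathrm{Nm}$, and let $B=E\oplus E\mathbf j$ be the quaternion algebra with $\mathbf j^2=J$, $\mathbf j\mathbf i=-\mathbf i\mathbf j$, main involution $x\mapsto x^*$, and projection $\mathrm{pr}\colon B\to E$ onto the first summand. Write $(\cdot,\cdot)_F$ for the Hilbert symbol, $\epsilon_{E/F}=(\cdot,u)_F$, and let $\xi,\xi'\colon E^\times\to\mathbb C^1$ be characters with $\xi|_{F^\times}=\xi'|_{F^\times}=\epsilon_{E/F}$. *Spaces.* Let $V_0=E$ be the right $E$-space with Hermitian form $\bar a b$; $W_0=B$ the left $E$-space with skew-Hermitian form $-\mathbf i\,\mathrm{pr}(xy^*)$; $\mathrm{Res}\,V=B$ the right $E$-space with skew-Hermitian form $\mathrm{pr}(x^*\mathbf i y)$; and $W=E$ the left $E$-space with Hermitian form $a\bar b$. For each of the pairs $(\mathbb V_1,\mathbb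 W_1)=(V_0,W_0)$ and $(\mathrm{Res}\,V,W)$, let $G(U_E(\mathbb V_1)\times U_E(\mathbb W_1))$ be the group of pairs of $E$-linear similitudes $(g,h)$, $g$ acting on the left and $h$ on the right, with the same similitude factor in $F^\times$. Identify $V_0\otimes_E W_0=W_0$ and $\mathrm{Res}\,V\otimes_E W=\mathrm{Res}\,V$; both have the underlying $F$-space $\mathbb V=B$, with the same symplectic form $\langle\!\langle x,y\rangle\!\rangle=\frac12\mathrm{Tr}\,\mathrm{pr}(x^*\mathbf i y)$. For a space $M$ with a form, $M^\square=M\oplus M^-$, where $M^-$ carries the negated form, and $M^\triangle\subset M^\square$ is the diagonal. Let $$i\colon G(U_E(V_0)\times U_E(W_0))\to U_E(W_0^\square),\qquad i'\colon G(U_E(\mathrm{Res}\,V)\times U_E(W))\to U_E(\mathrm{Res}\,V^\square)$$ send $(g,h)$ to the map that acts by $x\mapsto g^{-1}xh$ on the first summand and trivially on the second. Both unitary groups are subgroups of $\mathrm{Sp}(\mathbb V^\square)$, which acts on the right. Fix a complete polarization $\mathbb V=\mathbb X+\mathbb Y$ and put $\mathbb Y^\square=\mathbb Y\oplus\mathbb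 Y^-$. *Weil indices.* For a nondegenerate quadratic function $Q$ on a finite-dimensional $F$-space, $\gamma_F(\psi\circ Q)\in\mathbb C^1$ is the Weil index of the character of second degree $x\mapsto\psi(Q(x))$. Put $\gamma_F(u,\frac12\psi)=\gamma_F(\psi(\frac12ux^2))/\gamma_F(\psi(\frac12x^2))$. For Lagrangian subspaces $Y_0,Y_1,Y_2$ of a symplectic space, with $R=Y_0\cap Y_1+Y_1\cap Y_2+Y_2\cap Y_0$ and $(Y_i)_R$ the image of $Y_i\cap R^\perp$ in $R^\perp/R$, the Leray invariant $q(Y_0,Y_1,Y_2)$ is the nondegenerate symmetric form on $(Y_1)_R$ with $q(y,y)=\langle\!\langle y,yb\rangle\!\rangle$, where $b\colon(Y_1)_R\to(Y_0)_R$ is the linear map such that $y+yb\in(Y_2)_R$ for all $y$; and $\gamma_F(\frac12\psi\circ q)$ is the Weil index of $y\mapsto\psi(\frac12q(y,y))$. Define $$\lambda(g)=\gamma_F(\tfrac12\psi\circ q(\mathbb V^\triangle,\mathbb Y^\square g^{-1},\mathbb Y^\square))\cdot\gamma_F(\tfrac12\psi\circ q(\mathbb V^\triangle,\mathbb Y^\square,\mathbb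 V^\triangle g)),\qquad g\in\mathrm{Sp}(\mathbb V^\square).$$ *Splittings.* Let $M$ be $W_0$ or $\mathrm{Res}\,V$. The vectors $v_1=(-\frac{\mathbf i}{2u},\frac{\mathbf i}{2u})$, $v_2=(\frac{\mathbf i\mathbf j}{2uJ},-\frac{\mathbf i\mathbf j}{2uJ})$, $v_1'=(1,1)$, $v_2'=(\mathbf j,\mathbf j)$ form a Witt basis of $M^\square$. Let $P\subset U_E(M^\square)$ be the stabilizer of $Y=\mathrm{span}_E(v_1',v_2')=M^\triangle$, and for $0\le j\le2$ let $\tau_j\in U_E(M^\square)$ send $v_k\mapsto-v_k'$, $v_k'\mapsto v_k$ for $k\le j$ and fix $v_k,v_k'$ for $k>j$. If $g=p_1\tau_jp_2$ with $p_1,p_2\in P$ (product for the right action), put $j(g)=j$ and $x(g)=\det(p_1p_2|_Y)\in E^\times$, which is well defined up to $\mathrm{Nm}(E^\times)$. Define $$\beta_{\xi}(g)=\xi(x(g))\,\bigl((u,-1)_F\,\gamma_F(u,\tfrac12\psi)\bigr)^{-j(g)}\ \text{ on }U_E(W_0^\square),\qquad \beta'_{\xi'}(g)=\xi'(x(g))\,\bigl((u,-1)_F\,\gamma_F(u,\tfrac12\psi)\bigr)^{-j(g)}\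 \text{ on }U_E(\mathrm{Res}\,V^\square),$$ and $s=i^*(\beta_{\xi}\lambda)$ on $G(U_E(V_0)\times U_E(W_0))$, $s'=(i')^*(\beta'_{\xi'}\lambda)$ on $G(U_E(\mathrm{Res}\,V)\times U_E(W))$. **Proposition.** Let $\alpha,\beta\in E^\times$ with $\mathrm{Nm}(\alpha)=\mathrm{Nm}(\beta)$. Let $g\in G(U_E(V_0)\times U_E(W_0))$ be given by multiplication by $\alpha$ on $V_0$ and right multiplication by $\beta$ on $W_0=B$, and let $g'\in G(U_E(\mathrm{Res}\,V)\times U_E(W))$ be given by left multiplication by $\alpha$ on $\mathrm{Res}\,V=B$ and multiplication by $\beta$ on $W$. Then $$s'(g')=\xi(\alpha)\,\xi'(\beta)\,s(g).$$ -/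

import Mathlib

open scoped Quaternion

noncomputable section

namespace KudlaSplitting

/-! ## Weil index and Hilbert symbol over a local field -/

section WeilIndex

variable {F : Type*} [NontriviallyNormedField F] [LocallyCompactSpace F]

/-- `γ` is the Weil index of the character of second degree `f` on `Fⁿ`: it has absolute value one
and, for some constant `c > 0` (which absorbs the choice of Haar measures),
`∫ (φ * f) = γ c ∫ φ` for every test function `φ`. -/
def IsWeilIndex {n : ℕ} (f : (Fin n → F) → ℂ) (γ : ℂ) : Prop :=
  letI : MeasurableSpace (Fin n → F) := borel (Fin n → F)
  haveI : BorelSpace (Fin n → F) := ⟨rfl⟩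
  let μ : MeasureTheory.Measure (Fin n → F) := MeasureTheory.Measure.addHaar
  ‖γ‖ = 1 ∧ ∃ c : ℝ, 0 < c ∧ ∀ φ : (Fin n → F) → ℂ, Continuous φ → HasCompactSupport φ →
    MeasureTheory.Integrable (fun x => ∫ y, φ y * f (x - y) ∂μ) μ →
      ∫ x, (∫ y, φ y * f (x - y) ∂μ) ∂μ = γ * (c : ℂ) * ∫ x, φ x ∂μ

open Classical in
/-- The Weil index of the character of second degree `x ↦ ψ (Q x)` of a finite-dimensional
`F`-vector space `M`, for a nondegenerate quadratic function `Q`. -/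
def weilIndex (ψ : AddChar F Circle) {M : Type*} [AddCommGroup M] [Module F M]
    [Module.Finite F M] (Q : M → F) : ℂ :=
  let f : (Fin (Module.finrank F M) → F) → ℂ :=
    fun x => (ψ (Q ((Module.finBasis F M).equivFun.symm x)) : ℂ)
  if h : ∃ γ : ℂ, IsWeilIndex f γ then h.choose else 1

/-- The relative Weil index `γ_F(a, ½ψ) = γ_F(a · ½ψ) / γ_F(½ψ)`, where `γ_F(η)` is the Weil index
of `x ↦ η (x²)` on `F`. -/
def relWeilIndex (ψ : AddChar F Circle) (a : F) : ℂ :=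
  weilIndex ψ (fun x : F => 2⁻¹ * (a * x ^ 2)) / weilIndex ψ (fun x : F => 2⁻¹ * x ^ 2)

end WeilIndex

open Classical in
/-- The Hilbert symbol `(a, b)_F`. -/
def hilbertSymbol {F : Type*} [Field F] (a b : F) : ℤ :=
  if ∃ x y z : F, (x, y, z) ≠ (0, 0, 0) ∧ z ^ 2 = a * x ^ 2 + b * y ^ 2 then 1 else -1

/-! ## The Leray invariant -/

section Leray

variable {F : Type*} [Field F] {S : Type*} [AddCommGroup S] [Module F S]

/-- `R = Y₀ ∩ Y₁ + Y₁ ∩ Y₂ + Y₂ ∩ Y₀`. -/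
def lerayR (Y₀ Y₁ Y₂ : Submodule F S) : Submodule F S := Y₀ ⊓ Y₁ ⊔ Y₁ ⊓ Y₂ ⊔ Y₂ ⊓ Y₀

/-- `R^⊥`. -/
def lerayPerp (B : LinearMap.BilinForm F S) (Y₀ Y₁ Y₂ : Submodule F S) : Submodule F S :=
  B.orthogonal (lerayR Y₀ Y₁ Y₂)

/-- The symplectic space `S_R = R^⊥ / R`. -/
abbrev LerayQuot (B : LinearMap.BilinForm F S) (Y₀ Y₁ Y₂ : Submodule F S) : Type _ :=
  ↥(lerayPerp B Y₀ Y₁ Y₂) ⧸ (lerayR Y₀ Y₁ Y₂).submoduleOf (lerayPerp B Y₀ Y₁ Y₂)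

/-- The image `Y_R` in `S_R` of `Y ∩ R^⊥`. -/
def lerayImage (B : LinearMap.BilinForm F S) (Y₀ Y₁ Y₂ Y : Submodule F S) :
    Submodule F (LerayQuot B Y₀ Y₁ Y₂) :=
  (Y.submoduleOf (lerayPerp B Y₀ Y₁ Y₂)).map (Submodule.mkQ _)

/-- The symplectic form of `S_R`, computed on representatives. -/
def lerayForm (B : LinearMap.BilinForm F S) (Y₀ Y₁ Y₂ : Submodule F S)
    (a b : LerayQuot B Y₀ Y₁ Y₂) : F :=
  B (Quotient.out a : ↥(lerayPerp B Y₀ Y₁ Y₂)) (Quotient.out b : ↥(lerayPerp B Y₀ Y₁ Y₂))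

open Classical in
/-- The Leray invariant `q(Y₀, Y₁, Y₂)`, as a quadratic function on `(Y₁)_R`. The spaces
`(Yᵢ)_R` are pairwise transverse, so there is a unique unipotent `σ = 1 + b` with
`b : (Y₁)_R → (Y₀)_R` that carries `(Y₁)_R` onto `(Y₂)_R`, and the invariant is
`y ↦ ⟪y, y b⟫`; here `y b` is the element `z` of `(Y₀)_R` with `y + z ∈ (Y₂)_R`. -/
def leray (B : LinearMap.BilinForm F S) (Y₀ Y₁ Y₂ : Submodule F S)
    (y : ↥(lerayImage B Y₀ Y₁ Y₂ Y₁)) : F :=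
  if h : ∃ z ∈ lerayImage B Y₀ Y₁ Y₂ Y₀,
      (y : LerayQuot B Y₀ Y₁ Y₂) + z ∈ lerayImage B Y₀ Y₁ Y₂ Y₂ then
    lerayForm B Y₀ Y₁ Y₂ y h.choose
  else 0

end Leray

section Lambda

variable {F : Type*} [NontriviallyNormedField F] [LocallyCompactSpace F]
  {S : Type*} [AddCommGroup S] [Module F S] [Module.Finite F S]

/-- `γ_F(½ψ ∘ q(Y₀, Y₁, Y₂))`. -/
def lerayWeil (ψ : AddChar F Circle) (B : LinearMap.BilinForm F S)
    (Y₀ Y₁ Y₂ : Submodule F S) : ℂ :=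
  weilIndex ψ (fun y : ↥(lerayImage B Y₀ Y₁ Y₂ Y₁) => 2⁻¹ * leray B Y₀ Y₁ Y₂ y)

/-- The change-of-polarization function `λ_{Y ⇝ Y'}` at an element `g` of the symplectic group
(acting on the right):
`λ(g) = γ_F(½ψ ∘ q(Y, Y' g⁻¹, Y')) · γ_F(½ψ ∘ q(Y, Y', Y g))`. -/
def lambda (ψ : AddChar F Circle) (B : LinearMap.BilinForm F S) (Y Y' : Submodule F S)
    (g : S ≃ₗ[F] S) : ℂ :=
  lerayWeil ψ B Y (Y'.map (g.symm : S →ₗ[F] S)) Y' *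
    lerayWeil ψ B Y Y' (Y.map (g : S →ₗ[F] S))

end Lambda

/-! ## Unitary and similitude groups, and the Bruhat decomposition -/

section Unitary

variable {E : Type*} [CommRing E]

/-- `g` lies in the unitary group of the form `h`. -/
def IsUnitary {N : Type*} [AddCommGroup N] [Module E N] (h : N → N → E) (g : N ≃ₗ[E] N) : Prop :=
  ∀ x y, h (g x) (g y) = h x y

/-- The doubled form on `M ⊕ M⁻`. -/
def dblForm {M : Type*} (h : M → M → E) (x y : M × M) : E := h x.1 y.1 - h x.2 y.2

/-- The automorphism of `M ⊕ M⁻` that acts by `T` on the first summand and trivially on the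
second. -/
def dblMap {M : Type*} [AddCommGroup M] [Module E M] (T : M ≃ₗ[E] M) : (M × M) ≃ₗ[E] (M × M) :=
  T.prodCongr (LinearEquiv.refl E M)

/-- `p` lies in the parabolic subgroup `P_Y` of the unitary group of `h` which stabilizes
`Y = span (e'₁, …, e'ₙ)`. -/
def IsParabolic {N : Type*} [AddCommGroup N] [Module E N] (h : N → N → E) {n : ℕ}
    (e' : Fin n → N) (p : N ≃ₗ[E] N) : Prop :=
  IsUnitary h p ∧ ∀ y, p y ∈ Submodule.span E (Set.range e') ↔ y ∈ Submodule.span E (Set.range e')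

/-- `τ = τ_j` for the basis `e₁, …, eₙ, e'₁, …, e'ₙ`: it sends `eᵢ ↦ -e'ᵢ` and `e'ᵢ ↦ eᵢ` for the
first `j` indices, and fixes the other basis vectors. -/
def IsTau {N : Type*} [AddCommGroup N] [Module E N] {n : ℕ} (e e' : Fin n → N) (j : ℕ)
    (τ : N ≃ₗ[E] N) : Prop :=
  (∀ i : Fin n, (i : ℕ) < j → τ (e i) = -e' i ∧ τ (e' i) = e i) ∧
    ∀ i : Fin n, j ≤ (i : ℕ) → τ (e i) = e i ∧ τ (e' i) = e' i

/-- `g = p₁ τ_j p₂` (a right action: `p₁` is applied first) with `p₁, p₂ ∈ P_Y` and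
`x = det (p₁ p₂ |_Y)`; that is, `j = j(g)` and `x` is a value of `x(g)`. -/
def IsBruhat {N : Type*} [AddCommGroup N] [Module E N] (h : N → N → E) {n : ℕ}
    (e e' : Fin n → N) (g : N ≃ₗ[E] N) (j : ℕ) (x : Eˣ) : Prop :=
  j ≤ n ∧ ∃ p₁ τ p₂ : N ≃ₗ[E] N, IsParabolic h e' p₁ ∧ IsParabolic h e' p₂ ∧ IsTau e e' j τ ∧
    (∀ w, g w = p₂ (τ (p₁ w))) ∧
    ∃ hY : ∀ y ∈ Submodule.span E (Set.range e'),
        ((p₁.trans p₂ : N ≃ₗ[E] N) : N →ₗ[E] N) y ∈ Submodule.span E (Set.range e'),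
      (x : E) = LinearMap.det
        (LinearMap.restrict ((p₁.trans p₂ : N ≃ₗ[E] N) : N →ₗ[E] N) hY)

open Classical in
/-- The pair `(j(g), x(g))`. The element `x(g)` depends on the decomposition only up to norms from
`Eˣ`; one value is chosen. -/
def bruhatDatum {N : Type*} [AddCommGroup N] [Module E N] (h : N → N → E) {n : ℕ}
    (e e' : Fin n → N) (g : N ≃ₗ[E] N) : ℕ × Eˣ :=
  if H : ∃ d : ℕ × Eˣ, IsBruhat h e e' g d.1 d.2 then H.choose else (0, 1)

/-- The group `G(U(V) × U(W))` of pairs of similitudes with the same similitude factor in `Fˣ`.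
The first component acts on the left of `V`, the second on the right of `W`. -/
def GPair (F : Type*) [Field F] [Algebra F E] {V W : Type*} [AddCommGroup V] [Module E V]
    [AddCommGroup W] [Module E W] (hV : V → V → E) (hW : W → W → E) : Type _ :=
  {p : (V ≃ₗ[E] V) × (W ≃ₗ[E] W) // ∃ ν : Fˣ,
    (∀ x y, hV (p.1 x) (p.1 y) = algebraMap F E ν * hV x y) ∧
    (∀ x y, hW (p.2 x) (p.2 y) = algebraMap F E ν * hW x y)}

end Unitary

/-! ## The algebras `E = F[𝐢]` and `B = E ⊕ E𝐣`, and the spaces built from them -/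

section Spaces

variable {F : Type*} [Field F] (u J : F)

/-- `E = F[𝐢]`, `𝐢² = u`; its involution is `star` and `E ≅ F × F` is allowed. -/
abbrev QE : Type _ := QuadraticAlgebra F u 0

/-- The element `𝐢` of `E`. -/
def iE : QE u := ⟨0, 1⟩

/-- The quaternion algebra `B` with standard basis `1, 𝐢, 𝐣, 𝐢𝐣`, where `𝐢² = u`, `𝐣² = J`,
`𝐣𝐢 = -𝐢𝐣`; its main involution is `star`. -/
abbrev QB : Type _ := ℍ[F, u, 0, J]

/-- The inclusion of `E` in `B`. -/
def emb : QE u →ₐ[F] QB u J where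
  toFun a := ⟨a.re, a.im, 0, 0⟩
  map_one' := by ext <;> rfl
  map_mul' a b := by ext <;> simp
  map_zero' := by ext <;> simp
  map_add' a b := by ext <;> simp
  commutes' r := by ext <;> simp

/-- The projection of `B = E ⊕ E𝐣` onto `E`. -/
def pr (x : QB u J) : QE u := ⟨x.re, x.imI⟩

/-- The element `𝐣` of `B`. -/
def jB : QB u J := ⟨0, 0, 1, 0⟩

/-- `W₀ = B` as a left `E`-space. -/
def W0 : Type _ := QB u J

/-- `Res V = B` as a right `E`-space. Since `E` is commutative it is viewed as an `E`-module:
`a • x = x a`. -/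
def ResV : Type _ := QB u J

instance : AddCommGroup (W0 u J) := inferInstanceAs (AddCommGroup (QB u J))
instance : AddCommGroup (ResV u J) := inferInstanceAs (AddCommGroup (QB u J))
instance : Module F (W0 u J) := inferInstanceAs (Module F (QB u J))
instance : Module F (ResV u J) := inferInstanceAs (Module F (QB u J))

/-- The identity map `W₀ = B`. -/
def W0.toB : W0 u J ≃ₗ[F] QB u J := LinearEquiv.refl F (QB u J)

/-- The identity map `Res V = B`. -/
def ResV.toB : ResV u J ≃ₗ[F] QB u J := LinearEquiv.refl F (QB u J)

instance : Module (QE u) (W0 u J) where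
  smul a x := (W0.toB u J).symm (emb u J a * W0.toB u J x)
  one_smul x := by
    change emb u J 1 * (W0.toB u J x) = (W0.toB u J x)
    rw [map_one, one_mul]
  mul_smul a b x := by
    change emb u J (a * b) * (W0.toB u J x) = emb u J a * (emb u J b * (W0.toB u J x))
    rw [map_mul, mul_assoc]
  smul_zero a := mul_zero (emb u J a)
  smul_add a x y := mul_add (emb u J a) (W0.toB u J x) (W0.toB u J y)
  add_smul a b x := by
    change emb u J (a + b) * (W0.toB u J x) = emb u J a * (W0.toB u J x) + emb u J b * (W0.toB u J x)
    rw [map_add, add_mul]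
  zero_smul x := by
    change emb u J 0 * (W0.toB u J x) = 0
    rw [map_zero, zero_mul]

instance : Module (QE u) (ResV u J) where
  smul a x := (ResV.toB u J).symm (ResV.toB u J x * emb u J a)
  one_smul x := by
    change (ResV.toB u J x) * emb u J 1 = (ResV.toB u J x)
    rw [map_one, mul_one]
  mul_smul a b x := by
    change (ResV.toB u J x) * emb u J (a * b) = ((ResV.toB u J x) * emb u J b) * emb u J a
    rw [mul_comm a b, map_mul, mul_assoc]
  smul_zero a := zero_mul (emb u J a)
  smul_add a x y := add_mul (ResV.toB u J x) (ResV.toB u J y) (emb u J a)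
  add_smul a b x := by
    change (ResV.toB u J x) * emb u J (a + b) = (ResV.toB u J x) * emb u J a + (ResV.toB u J x) * emb u J b
    rw [map_add, mul_add]
  zero_smul x := by
    change (ResV.toB u J x) * emb u J 0 = 0
    rw [map_zero, mul_zero]

instance : IsScalarTower F (QE u) (W0 u J) where
  smul_assoc r a x := by
    change emb u J (r • a) * (W0.toB u J x) = r • (emb u J a * (W0.toB u J x))
    rw [map_smul, smul_mul_assoc]

instance : IsScalarTower F (QE u) (ResV u J) where
  smul_assoc r a x := by
    change (ResV.toB u J x) * emb u J (r • a) = r • ((ResV.toB u J x) * emb u J a)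
    rw [map_smul, mul_smul_comm]

/-- `V₀ = E` as a right `E`-space, with Hermitian form `⟨a, b⟩₀ = ā b`. -/
def hV0 (a b : QE u) : QE u := star a * b

/-- `W = E` as a left `E`-space, with Hermitian form `(a, b) = a b̄`. -/
def hW (a b : QE u) : QE u := a * star b

/-- The skew-Hermitian form `(x, y)₀ = -𝐢 pr(x y*)` of `W₀`. -/
def hW0 (x y : W0 u J) : QE u := -(iE u * pr u J (W0.toB u J x * star (W0.toB u J y)))

/-- The skew-Hermitian form `⟨x, y⟩ = pr(x* 𝐢 y)` of `Res V`. -/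
def hResV (x y : ResV u J) : QE u :=
  pr u J (star (ResV.toB u J x) * emb u J (iE u) * ResV.toB u J y)

/-- The symplectic form `½ Tr_{E/F} pr(x* 𝐢 y)` of the four-dimensional `F`-space
`𝕍 = Res V ⊗ W = B`. -/
def symp : LinearMap.BilinForm F (QB u J) :=
  LinearMap.mk₂ F (fun x y => 2⁻¹ * (QuadraticAlgebra.trace (pr u J (star x * emb u J (iE u) * y))))
    (by intros; simp [pr, emb, iE, QuadraticAlgebra.trace_def]; ring)
    (by intros; simp [pr, emb, iE, QuadraticAlgebra.trace_def]; ring)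
    (by intros; simp [pr, emb, iE, QuadraticAlgebra.trace_def]; ring)
    (by intros; simp [pr, emb, iE, QuadraticAlgebra.trace_def]; ring)

/-- The two descriptions `Res V ⊗ W` and `V₀ ⊗ W₀` of `𝕍 = B` carry the same symplectic form. -/
theorem symp_eq_W0 (x y : W0 u J) :
    symp u J (W0.toB u J x) (W0.toB u J y) = 2⁻¹ * QuadraticAlgebra.trace (hW0 u J x y) := by
  simp [symp, hW0, pr, emb, iE, QuadraticAlgebra.trace_def]
  ring

/-- The symplectic form of `𝕍^□ = 𝕍 ⊕ 𝕍⁻`. -/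
def sympDbl : LinearMap.BilinForm F (QB u J × QB u J) :=
  (symp u J).compl₁₂ (LinearMap.fst F _ _) (LinearMap.fst F _ _) -
    (symp u J).compl₁₂ (LinearMap.snd F _ _) (LinearMap.snd F _ _)

/-- The diagonal `𝕍^△ = V₀ ⊗ W₀^△ = Res V^△ ⊗ W` of `𝕍^□`. -/
def diag : Submodule F (QB u J × QB u J) :=
  LinearMap.range (LinearMap.prod LinearMap.id LinearMap.id : QB u J →ₗ[F] QB u J × QB u J)

/-- `𝕍 = X + Y` is a complete polarization. -/
def IsPolarization (X Y : Submodule F (QB u J)) : Prop :=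
  IsCompl X Y ∧ (∀ x ∈ X, ∀ x' ∈ X, symp u J x x' = 0) ∧ (∀ y ∈ Y, ∀ y' ∈ Y, symp u J y y' = 0)

/-- The vectors `v₁, v₂` of `B ⊕ B⁻`. -/
def wittV : Fin 2 → QB u J × QB u J :=
  ![((-(2 * u)⁻¹) • emb u J (iE u), (2 * u)⁻¹ • emb u J (iE u)),
    ((2 * u * J)⁻¹ • (emb u J (iE u) * jB u J), (-(2 * u * J)⁻¹) • (emb u J (iE u) * jB u J))]

/-- The vectors `v'₁, v'₂` of `B ⊕ B⁻`, which span the diagonal. -/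
def wittV' : Fin 2 → QB u J × QB u J := ![(1, 1), (jB u J, jB u J)]

/-- `V₀ ⊗ W₀ ≅ W₀` and the map `i : G(U(V₀) × U(W₀)) → U(W₀^□)`,
`(g, h) ↦ ((v ⊗ w, v⁻ ⊗ w⁻) ↦ (g⁻¹ v ⊗ w h, v⁻ ⊗ w⁻))`. -/
def i0 (p : GPair F (hV0 u) (hW0 u J)) : (W0 u J × W0 u J) ≃ₗ[QE u] (W0 u J × W0 u J) :=
  dblMap ((TensorProduct.lid (QE u) (W0 u J)).symm ≪≫ₗ
    TensorProduct.congr p.1.1.symm p.1.2 ≪≫ₗ TensorProduct.lid (QE u) (W0 u J))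

/-- `Res V ⊗ W ≅ Res V` and the map `i' : G(U(Res V) × U(W)) → U(Res V^□)`,
`(g, h) ↦ ((v, v⁻) ↦ (g⁻¹ v h, v⁻))`. -/
def i1 (p : GPair F (hResV u J) (hW u)) :
    (ResV u J × ResV u J) ≃ₗ[QE u] (ResV u J × ResV u J) :=
  dblMap ((TensorProduct.rid (QE u) (ResV u J)).symm ≪≫ₗ
    TensorProduct.congr p.1.1.symm p.1.2 ≪≫ₗ TensorProduct.rid (QE u) (ResV u J))

/-- The embedding of `U(W₀^□)` in `Sp(𝕍^□)`. -/
def iota0 (g : (W0 u J × W0 u J) ≃ₗ[QE u] (W0 u J × W0 u J)) :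
    (QB u J × QB u J) ≃ₗ[F] (QB u J × QB u J) :=
  ((W0.toB u J).prodCongr (W0.toB u J)).symm ≪≫ₗ g.restrictScalars F ≪≫ₗ
    (W0.toB u J).prodCongr (W0.toB u J)

/-- The embedding of `U(Res V^□)` in `Sp(𝕍^□)`. -/
def iota1 (g : (ResV u J × ResV u J) ≃ₗ[QE u] (ResV u J × ResV u J)) :
    (QB u J × QB u J) ≃ₗ[F] (QB u J × QB u J) :=
  ((ResV.toB u J).prodCongr (ResV.toB u J)).symm ≪≫ₗ g.restrictScalars F ≪≫ₗ
    (ResV.toB u J).prodCongr (ResV.toB u J)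

/-- Right multiplication by `β` on the left `E`-space `W₀ = B`. -/
def rmulW0 (β : (QE u)ˣ) : W0 u J ≃ₗ[QE u] W0 u J where
  toFun w := (W0.toB u J).symm (W0.toB u J w * emb u J β)
  invFun w := (W0.toB u J).symm (W0.toB u J w * emb u J (β⁻¹ : (QE u)ˣ))
  map_add' x y := add_mul (W0.toB u J x) (W0.toB u J y) (emb u J β)
  map_smul' a x := mul_assoc (emb u J a) (W0.toB u J x) (emb u J β)
  left_inv x := by
    change (W0.toB u J x) * emb u J β * emb u J (β⁻¹ : (QE u)ˣ) = (W0.toB u J x)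
    rw [mul_assoc, ← map_mul, Units.mul_inv, map_one, mul_one]
  right_inv x := by
    change (W0.toB u J x) * emb u J (β⁻¹ : (QE u)ˣ) * emb u J β = (W0.toB u J x)
    rw [mul_assoc, ← map_mul, Units.inv_mul, map_one, mul_one]

/-- Left multiplication by `α` on the right `E`-space `Res V = B`. -/
def lmulResV (α : (QE u)ˣ) : ResV u J ≃ₗ[QE u] ResV u J where
  toFun v := (ResV.toB u J).symm (emb u J α * ResV.toB u J v)
  invFun v := (ResV.toB u J).symm (emb u J (α⁻¹ : (QE u)ˣ) * ResV.toB u J v)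
  map_add' x y := mul_add (emb u J α) (ResV.toB u J x) (ResV.toB u J y)
  map_smul' a x := (mul_assoc (emb u J α) (ResV.toB u J x) (emb u J a)).symm
  left_inv x := by
    change emb u J (α⁻¹ : (QE u)ˣ) * (emb u J α * (ResV.toB u J x)) = (ResV.toB u J x)
    rw [← mul_assoc, ← map_mul, Units.inv_mul, map_one, one_mul]
  right_inv x := by
    change emb u J α * (emb u J (α⁻¹ : (QE u)ˣ) * (ResV.toB u J x)) = (ResV.toB u J x)
    rw [← mul_assoc, ← map_mul, Units.mul_inv, map_one, one_mul]

/-- The norm `Eˣ → Fˣ`. -/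
def normU : (QE u)ˣ →* Fˣ := Units.map QuadraticAlgebra.norm

/-- The pair `(α, β)` with `Nm α = Nm β` as an element of
`G(U(V₀) × U(W)) ⊂ G(U(V₀) × U(W₀))`: `α` acts on `V₀ = E` by multiplication and `β` acts on
`W₀ = B` by right multiplication. -/
def torus0 (α β : (QE u)ˣ) (h : normU u α = normU u β) : GPair F (hV0 u) (hW0 u J) :=
  ⟨(LinearEquiv.smulOfUnit α, rmulW0 u J β), normU u α, by
    intro x y
    change star ((α : QE u) * x) * ((α : QE u) * y) =
      algebraMap F (QE u) (QuadraticAlgebra.norm (α : QE u)) * (star x * y)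
    rw [QuadraticAlgebra.algebraMap_norm_eq_mul_star, star_mul]
    ring, by
    intro x y
    rw [h]
    change -(iE u * pr u J (W0.toB u J x * emb u J β * star (W0.toB u J y * emb u J β))) =
      algebraMap F (QE u) (QuadraticAlgebra.norm (β : QE u)) * hW0 u J x y
    ext <;> simp [hW0, pr, emb, iE, QuadraticAlgebra.norm_def] <;> ring⟩

/-- The pair `(α, β)` with `Nm α = Nm β` as an element of
`G(U(V₀) × U(W)) ⊂ G(U(Res V) × U(W))`: `α` acts on `Res V = B` by left multiplication and `β`
acts on `W = E` by multiplication. -/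
def torus1 (α β : (QE u)ˣ) (h : normU u α = normU u β) : GPair F (hResV u J) (hW u) :=
  ⟨(lmulResV u J α, LinearEquiv.smulOfUnit β), normU u α, by
    intro x y
    change pr u J (star (emb u J α * ResV.toB u J x) * emb u J (iE u) *
        (emb u J α * ResV.toB u J y)) =
      algebraMap F (QE u) (QuadraticAlgebra.norm (α : QE u)) * hResV u J x y
    ext <;> simp [hResV, pr, emb, iE, QuadraticAlgebra.norm_def] <;> ring, by
    intro x y
    rw [h]
    change (β : QE u) * x * star ((β : QE u) * y) =
      algebraMap F (QE u) (QuadraticAlgebra.norm (β : QE u)) * (x * star y)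
    rw [QuadraticAlgebra.algebraMap_norm_eq_mul_star, star_mul]
    ring⟩

end Spaces

/-! ## The splittings -/

section Splittings

variable {F : Type*} [NontriviallyNormedField F] [LocallyCompactSpace F] (u J : F)

/-- Kudla's function `ξ(x(g)) ((u, -1)_F γ_F(u, ½ψ))^{-j(g)}`, in terms of the pair
`d = (j(g), x(g))`. -/
def kudla (ψ : AddChar F Circle) (ξ : (QE u)ˣ →* Circle) (d : ℕ × (QE u)ˣ) : ℂ :=
  (ξ d.2 : ℂ) * (((hilbertSymbol u (-1) : ℤ) : ℂ) * relWeilIndex ψ u) ^ (-(d.1 : ℤ))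

/-- The function `β` on `U(W₀^□)`. -/
def beta0 (ψ : AddChar F Circle) (ξ : (QE u)ˣ →* Circle)
    (g : (W0 u J × W0 u J) ≃ₗ[QE u] (W0 u J × W0 u J)) : ℂ :=
  kudla u ψ ξ (bruhatDatum (dblForm (hW0 u J))
    (fun k => ((W0.toB u J).prodCongr (W0.toB u J)).symm (wittV u J k))
    (fun k => ((W0.toB u J).prodCongr (W0.toB u J)).symm (wittV' u J k)) g)

/-- The function `β'` on `U(Res V^□)`. -/
def beta1 (ψ : AddChar F Circle) (ξ' : (QE u)ˣ →* Circle)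
    (g : (ResV u J × ResV u J) ≃ₗ[QE u] (ResV u J × ResV u J)) : ℂ :=
  kudla u ψ ξ' (bruhatDatum (dblForm (hResV u J))
    (fun k => ((ResV.toB u J).prodCongr (ResV.toB u J)).symm (wittV u J k))
    (fun k => ((ResV.toB u J).prodCongr (ResV.toB u J)).symm (wittV' u J k)) g)

/-- The splitting `s = i^*(β λ)` on `G(U(V₀) × U(W₀))`, with `λ = λ_{V₀ ⊗ W₀^△ ⇝ Y^□}`. -/
def s0 (ψ : AddChar F Circle) (ξ : (QE u)ˣ →* Circle) (Y : Submodule F (QB u J))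
    (p : GPair F (hV0 u) (hW0 u J)) : ℂ :=
  beta0 u J ψ ξ (i0 u J p) *
    lambda ψ (sympDbl u J) (diag u J) (Y.prod Y) (iota0 u J (i0 u J p))

/-- The splitting `s' = (i')^*(β' λ')` on `G(U(Res V) × U(W))`, with
`λ' = λ_{Res V^△ ⊗ W ⇝ Y^□}`. -/
def s1 (ψ : AddChar F Circle) (ξ' : (QE u)ˣ →* Circle) (Y : Submodule F (QB u J))
    (p : GPair F (hResV u J) (hW u)) : ℂ :=
  beta1 u J ψ ξ' (i1 u J p) *
    lambda ψ (sympDbl u J) (diag u J) (Y.prod Y) (iota1 u J (i1 u J p))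

end Splittings

end KudlaSplitting

end

open KudlaSplitting

/-!
Both `i` and `i'` send `(α, β)` to the map `x ↦ α⁻¹ x β` on the first summand of `𝕍^□`
(`iota0_i0_torus0`), so the two values of `λ` are the same number, and only the functions `β_ξ` and
`β'_{ξ'}` have to be compared. No property of Weil indices is used.

The map `x ↦ α⁻¹ x β` is diagonal, with entries of norm one: `μ = α⁻¹ β` and `ν = α⁻¹ β̄` on
`W₀ = E ⊕ E𝐣`, but `μ` and `ν̄ = ᾱ⁻¹ β` on `Res V = E ⊕ 𝐣E`. In the Witt basis the block `Y → M^□ / Y`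
of its extension to `M^□` is the diagonal matrix with entries `𝐢 (1 - μ)`, `-J 𝐢 (1 - ν)` for `W₀`,
and `𝐢 (1 - μ)`, `J 𝐢 (1 - ν̄)` for `Res V`. For `g = p₁ τ_j p₂` that block is `A₂^{-*} E_j A₁`, with
`Aᵢ` the action of `pᵢ` on `Y`. Hence `j(g)` is the number of its nonzero entries, each of which is a
unit even if `E` is split, and `x(g)` is their product up to norms (`IsBruhat.eq_card_and_eq_prod`,
`bruhatDatum_dblMap`). The numbers `j` agree, so the powers of the Weil index agree too.

Finally `Nm α = Nm β` gives `(1 - μ) (1 - ν) α = Tr α - Tr β` and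
`(1 - μ) (1 - ν̄) β̄ = Tr β - Tr α`; so `x(g) α` and `x(g') β̄` are, up to norms, the same element of
`F`, and likewise if `μ = 1` or `ν = 1` (`exists_algebraMap_eq`). As `ξ` and `ξ'` agree on `Fˣ` and
are trivial on norms, `ξ(x(g)) ξ(α) = ξ'(x(g')) ξ'(β)⁻¹`.
-/

namespace KudlaSplitting

open Matrix

/-! ### The split skew-Hermitian space -/

section SplitSpace

variable {E : Type*} [CommRing E] {n : ℕ}

/-- The split space `Eⁿ ⊕ Eⁿ`. -/
abbrev SplitSpace (E : Type*) (n : ℕ) : Type _ := (Fin n → E) × (Fin n → E)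

/-- The standard basis of the first summand of `Eⁿ ⊕ Eⁿ`. -/
def splitBasis (E : Type*) [CommRing E] {n : ℕ} (i : Fin n) : SplitSpace E n :=
  (Pi.single i 1, 0)

/-- The standard basis of the second summand of `Eⁿ ⊕ Eⁿ`. -/
def splitBasis' (E : Type*) [CommRing E] {n : ℕ} (i : Fin n) : SplitSpace E n :=
  (0, Pi.single i 1)

theorem mem_span_splitBasis' {y : SplitSpace E n} :
    y ∈ Submodule.span E (Set.range (splitBasis' (n := n) E)) ↔ y.1 = 0 := by
  have h : Set.range (splitBasis' (n := n) E) =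
      (LinearMap.inr E (Fin n → E) (Fin n → E)) '' Set.range (Pi.basisFun E (Fin n)) := by
    rw [← Set.range_comp]
    congr 1
    ext i : 1
    simp [splitBasis']
  rw [h, Submodule.span_image, Module.Basis.span_eq, Submodule.map_top, LinearMap.range_inr]
  simp

/-- The endomorphism of the second summand of `Eⁿ ⊕ Eⁿ` induced by `p`. -/
def lowerBlock (p : SplitSpace E n ≃ₗ[E] SplitSpace E n) : (Fin n → E) →ₗ[E] (Fin n → E) :=
  LinearMap.snd E _ _ ∘ₗ p.toLinearMap ∘ₗ LinearMap.inr E _ _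

theorem det_restrict_eq_det_lowerBlock (p : SplitSpace E n ≃ₗ[E] SplitSpace E n)
    (hY : ∀ y ∈ Submodule.span E (Set.range (splitBasis' (n := n) E)),
      p.toLinearMap y ∈ Submodule.span E (Set.range (splitBasis' (n := n) E))) :
    LinearMap.det (p.toLinearMap.restrict hY) = LinearMap.det (lowerBlock p) := by
  let f : Submodule.span E (Set.range (splitBasis' (n := n) E)) ≃ₗ[E] (Fin n → E) :=
    { toFun := fun y => y.1.2
      invFun := fun w => ⟨(0, w), mem_span_splitBasis'.2 rfl⟩
      map_add' := fun _ _ => rfl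
      map_smul' := fun _ _ => rfl
      left_inv := fun y => Subtype.ext (Prod.ext (mem_span_splitBasis'.1 y.2).symm rfl)
      right_inv := fun _ => rfl }
  rw [← LinearMap.det_conj _ f]
  rfl

/-- In coordinates, `τ_j` is `(v, w) ↦ (w, -v)` in the first `j` coordinates and the identity in
the others. -/
theorem IsTau.apply {j : ℕ} {τ : SplitSpace E n ≃ₗ[E] SplitSpace E n}
    (hτ : IsTau (splitBasis E) (splitBasis' E) j τ) (x : SplitSpace E n) :
    τ x = (fun i : Fin n => if (i : ℕ) < j then x.2 i else x.1 i,
      fun i : Fin n => if (i : ℕ) < j then -x.1 i else x.2 i) := by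
  have hx : x = ∑ i, (x.1 i • splitBasis E i + x.2 i • splitBasis' E i) := by
    ext k <;> simp [splitBasis, splitBasis', Prod.fst_sum, Prod.snd_sum, Pi.single_apply]
  have h : ∀ i, τ (x.1 i • splitBasis E i + x.2 i • splitBasis' E i) =
      if (i : ℕ) < j then x.1 i • (-splitBasis' E i) + x.2 i • splitBasis E i
      else x.1 i • splitBasis E i + x.2 i • splitBasis' E i := by
    intro i
    split_ifs with hi
    · rw [map_add, map_smul, map_smul, (hτ.1 i hi).1, (hτ.1 i hi).2]
    · rw [map_add, map_smul, map_smul, (hτ.2 i (not_lt.1 hi)).1, (hτ.2 i (not_lt.1 hi)).2]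
  have h' := congrArg τ hx
  rw [map_sum, Finset.sum_congr rfl fun i _ => h i] at h'
  rw [h']
  ext k
  · rw [Prod.fst_sum, Finset.sum_apply, Finset.sum_eq_single k]
    · split_ifs with hk <;> simp [splitBasis, splitBasis', hk]
    · intro b _ hb
      split_ifs <;> simp [splitBasis, splitBasis', hb.symm]
    · simp
  · rw [Prod.snd_sum, Finset.sum_apply, Finset.sum_eq_single k]
    · split_ifs with hk <;> simp [splitBasis, splitBasis', hk]
    · intro b _ hb
      split_ifs <;> simp [splitBasis, splitBasis', hb.symm]
    · simp

variable [StarRing E]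

/-- The skew-Hermitian form of the split space `Eⁿ ⊕ Eⁿ`, in which the standard bases of the two
summands are dual to each other. -/
def splitForm (x y : SplitSpace E n) : E := x.1 ⬝ᵥ star y.2 - x.2 ⬝ᵥ star y.1

theorem IsParabolic.apply_inr {p : SplitSpace E n ≃ₗ[E] SplitSpace E n}
    (hp : IsParabolic splitForm (splitBasis' E) p) (w : Fin n → E) :
    p (0, w) = (0, lowerBlock p w) := by
  have := (hp.2 (0, w)).2 (mem_span_splitBasis'.2 rfl)
  exact Prod.ext (mem_span_splitBasis'.1 this) rfl

theorem IsParabolic.isUnit_det {p : SplitSpace E n ≃ₗ[E] SplitSpace E n}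
    (hp : IsParabolic splitForm (splitBasis' E) p) : IsUnit (LinearMap.det (lowerBlock p)) := by
  refine LinearMap.isUnit_det _ ((Module.End.isUnit_iff _).2 ⟨fun v w h => ?_, fun w => ?_⟩)
  · have : p (0, v) = p (0, w) := by rw [hp.apply_inr, hp.apply_inr, h]
    simpa using p.injective this
  · have h := mem_span_splitBasis'.1 ((hp.2 (p.symm (0, w))).1 (by
      rw [p.apply_symm_apply]; exact mem_span_splitBasis'.2 rfl))
    refine ⟨(p.symm (0, w)).2, ?_⟩
    have h2 : p.symm (0, w) = (0, (p.symm (0, w)).2) := Prod.ext h rfl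
    have h3 := hp.apply_inr (p.symm (0, w)).2
    rw [← h2, p.apply_symm_apply] at h3
    exact (congrArg Prod.snd h3).symm

/-- The matrix form of `g = p₁ τ_j p₂` on the Lagrangian `Y`: with `A₁`, `A₂` the actions of `p₁`,
`p₂` on `Y`, the block `Y → N / Y` of `g` is `A₂^{-*} E_j A₁`. -/
theorem dotProduct_star_lowerBlock {p₁ τ p₂ g : SplitSpace E n ≃ₗ[E] SplitSpace E n} {j : ℕ}
    (hp₁ : IsParabolic splitForm (splitBasis' E) p₁)
    (hp₂ : IsParabolic splitForm (splitBasis' E) p₂)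
    (hτ : IsTau (splitBasis E) (splitBasis' E) j τ) (hg : ∀ w, g w = p₂ (τ (p₁ w)))
    (y : Fin n → E) (k : Fin n) :
    (g (0, y)).1 ⬝ᵥ star (lowerBlock p₂ (Pi.single k 1)) =
      if (k : ℕ) < j then lowerBlock p₁ y k else 0 := by
  have h := hp₂.1 (τ (p₁ (0, y))) (0, Pi.single k 1)
  rw [← hg, hp₂.apply_inr, hp₁.apply_inr, hτ.apply] at h
  simpa [splitForm, ← Pi.single_star] using h

end SplitSpace

/-! ### Bruhat data of diagonal elements -/

section Diagonal

variable {E : Type*} [CommRing E] [StarRing E]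

/-- The matrix computation behind `IsBruhat.eq_card_and_eq_prod`: `key` says
`diag(c) = A₂^{-*} E_j A₁`, and `fix` says that `A₂ A₁` fixes the basis vectors killed by `diag(c)`.
The norm factor is `1` for `j = 0`, that of an entry of `A₂` for `j = 1`, and that of `det A₂` for
`j = 2`. -/
theorem bruhat_matrix_eq [Nontrivial E] [DecidableEq E] {c : Fin 2 → E}
    {A₁ A₂ : Matrix (Fin 2) (Fin 2) E} {j : ℕ}
    (hc : ∀ i, c i = 0 ∨ IsUnit (c i)) (hj : j ≤ 2) (hu₁ : IsUnit A₁.det) (hu₂ : IsUnit A₂.det)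
    (key : ∀ i k : Fin 2, c i * star (A₂ i k) = if (k : ℕ) < j then A₁ k i else 0)
    (fix : ∀ i k : Fin 2, c i = 0 → (A₂ * A₁) k i = if k = i then 1 else 0) :
    j = (if c 0 = 0 then 0 else 1) + (if c 1 = 0 then 0 else 1) ∧
      ∃ z : E, A₁.det * A₂.det = (if c 0 = 0 then 1 else c 0) * (if c 1 = 0 then 1 else c 1) *
        (z * star z) := by
  have row₂ : ∀ i, A₂ i 0 = 0 → A₂ i 1 = 0 → False := by
    intro i h0 h1
    refine hu₂.ne_zero (det_eq_zero_of_row_eq_zero i fun k => ?_)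
    fin_cases k <;> assumption
  have col₂ : ∀ k, A₂ 0 k = 0 → A₂ 1 k = 0 → False := by
    intro k h0 h1
    refine hu₂.ne_zero (det_eq_zero_of_column_eq_zero k fun i => ?_)
    fin_cases i <;> assumption
  have row₁ : ∀ k, A₁ k 0 = 0 → A₁ k 1 = 0 → False := by
    intro k h0 h1
    refine hu₁.ne_zero (det_eq_zero_of_row_eq_zero k fun i => ?_)
    fin_cases i <;> assumption
  have col₁ : ∀ i, A₁ 0 i = 0 → A₁ 1 i = 0 → False := by
    intro i h0 h1
    refine hu₁.ne_zero (det_eq_zero_of_column_eq_zero i fun k => ?_)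
    fin_cases k <;> assumption
  have cancel : ∀ i k, IsUnit (c i) → c i * star (A₂ i k) = 0 → A₂ i k = 0 :=
    fun i k hi h => star_eq_zero.1 (hi.mul_right_eq_zero.1 h)
  have k00 := key 0 0
  have k01 := key 0 1
  have k10 := key 1 0
  have k11 := key 1 1
  interval_cases j
  · simp only [Nat.not_lt_zero, if_false] at k00 k01 k10 k11
    have h0 : c 0 = 0 := (hc 0).resolve_right fun h =>
      row₂ 0 (cancel 0 0 h k00) (cancel 0 1 h k01)
    have h1 : c 1 = 0 := (hc 1).resolve_right fun h =>
      row₂ 1 (cancel 1 0 h k10) (cancel 1 1 h k11)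
    refine ⟨by simp [h0, h1], 1, ?_⟩
    have : A₂ * A₁ = 1 := by
      ext k i
      rw [one_apply, fix i k]
      fin_cases i <;> assumption
    rw [mul_comm, ← det_mul, this]
    simp [h0, h1]
  · simp only [Fin.val_zero, Fin.val_one, zero_lt_one, if_true, lt_irrefl, if_false]
      at k00 k01 k10 k11
    rcases hc 0 with h0 | h0 <;> rcases hc 1 with h1 | h1
    · rw [h0, zero_mul] at k00
      rw [h1, zero_mul] at k10
      exact (row₁ 0 k00.symm k10.symm).elim
    · have a := cancel 1 1 h1 k11
      have f := fix 0 0 h0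
      rw [h0, zero_mul] at k00
      refine ⟨by simp [h0, h1.ne_zero], A₂ 1 0, ?_⟩
      rw [mul_apply, Fin.sum_univ_two, ← k00, if_pos rfl] at f
      rw [det_fin_two, det_fin_two, a, ← k00, ← k10, if_pos h0, if_neg h1.ne_zero]
      linear_combination (c 1 * star (A₂ 1 0) * A₂ 1 0) * f
    · have a := cancel 0 1 h0 k01
      have f := fix 1 1 h1
      rw [h1, zero_mul] at k10
      refine ⟨by simp [h1, h0.ne_zero], A₂ 0 0, ?_⟩
      rw [mul_apply, Fin.sum_univ_two, ← k10, if_pos rfl] at f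
      rw [det_fin_two, det_fin_two, a, ← k00, ← k10, if_pos h1, if_neg h0.ne_zero]
      linear_combination (c 0 * star (A₂ 0 0) * A₂ 0 0) * f
    · exact (col₂ 1 (cancel 0 1 h0 k01) (cancel 1 1 h1 k11)).elim
  · simp only [Fin.val_zero, Fin.val_one, Nat.one_lt_two, two_pos, if_true] at k00 k01 k10 k11
    have h0 : c 0 ≠ 0 := fun h => by
      rw [h, zero_mul] at k00 k01
      exact col₁ 0 k00.symm k01.symm
    have h1 : c 1 ≠ 0 := fun h => by
      rw [h, zero_mul] at k10 k11
      exact col₁ 1 k10.symm k11.symm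
    refine ⟨by simp [h0, h1], A₂.det, ?_⟩
    rw [if_neg h0, if_neg h1, det_fin_two A₁, ← k00, ← k01, ← k10, ← k11, det_fin_two A₂, star_sub,
      star_mul', star_mul']
    ring

/-- For an element of the unitary group of `E² ⊕ E²` that acts on the second summand by
`w ↦ (c w, d w)` with diagonal matrices `c` and `d`, every Bruhat decomposition has `j` equal to the
number of nonzero `c i`, and `x` is their product up to norms. -/
theorem IsBruhat.eq_card_and_eq_prod [Nontrivial E] [DecidableEq E]
    {g : SplitSpace E 2 ≃ₗ[E] SplitSpace E 2}
    {c d : Fin 2 → E} (hg : ∀ w, g (0, w) = (c * w, d * w))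
    (hc : ∀ i, c i = 0 ∨ IsUnit (c i)) (hcd : ∀ i, c i = 0 → d i = 1) {j : ℕ} {x : Eˣ}
    (H : IsBruhat splitForm (splitBasis E) (splitBasis' E) g j x) :
    j = (if c 0 = 0 then 0 else 1) + (if c 1 = 0 then 0 else 1) ∧
      ∃ z : E, (x : E) = (if c 0 = 0 then 1 else c 0) * (if c 1 = 0 then 1 else c 1) *
        (z * star z) := by
  obtain ⟨hj, p₁, τ, p₂, hp₁, hp₂, hτ, hgw, hY, hx⟩ := H
  rw [det_restrict_eq_det_lowerBlock] at hx
  have hcomp : lowerBlock (p₁.trans p₂) = lowerBlock p₂ ∘ₗ lowerBlock p₁ := by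
    ext i : 2
    change (p₂ (p₁ (0, _))).2 = lowerBlock p₂ (lowerBlock p₁ _)
    rw [hp₁.apply_inr, hp₂.apply_inr]
    rfl
  rw [hcomp, LinearMap.det_comp, ← LinearMap.det_toMatrix', ← LinearMap.det_toMatrix'] at hx
  have hu₁ := hp₁.isUnit_det
  have hu₂ := hp₂.isUnit_det
  rw [← LinearMap.det_toMatrix'] at hu₁ hu₂
  set A₁ := LinearMap.toMatrix' (lowerBlock p₁) with hA₁
  set A₂ := LinearMap.toMatrix' (lowerBlock p₂) with hA₂
  have key : ∀ i k : Fin 2, c i * star (A₂ i k) = if (k : ℕ) < j then A₁ k i else 0 := by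
    intro i k
    have := dotProduct_star_lowerBlock hp₁ hp₂ hτ hgw (Pi.single i 1) k
    have hci : c * Pi.single i 1 = Pi.single i (c i) := by
      ext l
      by_cases hl : l = i
      · subst hl; simp
      · simp [hl]
    rw [hg, hci, single_dotProduct] at this
    simpa [hA₁, hA₂, LinearMap.toMatrix'_apply] using this
  -- Where `c` vanishes, `g` fixes the basis vector, and so does `p₁ p₂`.
  have fix : ∀ i k : Fin 2, c i = 0 → (A₂ * A₁) k i = if k = i then 1 else 0 := by
    intro i k hi
    have h := hgw (0, Pi.single i 1)
    rw [hg, hp₁.apply_inr, hτ.apply] at h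
    have h0 : ∀ k : Fin 2, (k : ℕ) < j → lowerBlock p₁ (Pi.single i 1) k = 0 := by
      intro k hk
      have := key i k
      rw [hi, zero_mul, if_pos hk] at this
      simpa [hA₁, LinearMap.toMatrix'_apply] using this.symm
    have h1 : ((fun k : Fin 2 => if (k : ℕ) < j then lowerBlock p₁ (Pi.single i 1) k
          else (0 : Fin 2 → E) k,
        fun k : Fin 2 => if (k : ℕ) < j then -(0 : Fin 2 → E) k
          else lowerBlock p₁ (Pi.single i 1) k) : SplitSpace E 2) =
        (0, lowerBlock p₁ (Pi.single i 1)) := by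
      ext k
      · by_cases hk : (k : ℕ) < j <;> simp [hk, h0]
      · by_cases hk : (k : ℕ) < j <;> simp [hk, h0]
    rw [h1, hp₂.apply_inr] at h
    have h2 := congrFun (congrArg Prod.snd h) k
    rw [hA₁, hA₂, ← LinearMap.toMatrix'_comp, LinearMap.toMatrix'_apply]
    rw [LinearMap.comp_apply]
    refine h2.symm.trans ?_
    by_cases hk : k = i
    · subst hk; simp [hcd _ hi]
    · simp [hk]
  rw [hx, mul_comm]
  exact bruhat_matrix_eq hc hj hu₁ hu₂ key fix

end Diagonal

/-! ### Existence of Bruhat decompositions -/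

section Existence

variable {E : Type*} [CommRing E]

theorem IsUnitary.trans {N : Type*} [AddCommGroup N] [Module E N] {h : N → N → E}
    {p q : N ≃ₗ[E] N} (hp : IsUnitary h p) (hq : IsUnitary h q) : IsUnitary h (p ≪≫ₗ q) :=
  fun x y => (hq (p x) (p y)).trans (hp x y)

theorem IsUnitary.symm {N : Type*} [AddCommGroup N] [Module E N] {h : N → N → E}
    {p : N ≃ₗ[E] N} (hp : IsUnitary h p) : IsUnitary h p.symm := fun x y => by
  rw [← hp, p.apply_symm_apply, p.apply_symm_apply]

variable {n : ℕ}

/-- The unipotent map `(v, w) ↦ (v, w + s v)`, with `s` a diagonal matrix. -/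
def shear (s : Fin n → E) : SplitSpace E n ≃ₗ[E] SplitSpace E n where
  toFun x := (x.1, x.2 + s * x.1)
  invFun x := (x.1, x.2 - s * x.1)
  map_add' x y := by
    refine Prod.ext rfl ?_
    change x.2 + y.2 + s * (x.1 + y.1) = x.2 + s * x.1 + (y.2 + s * y.1)
    ring
  map_smul' a x := by
    refine Prod.ext rfl ?_
    change a • x.2 + s * (a • x.1) = a • (x.2 + s * x.1)
    rw [smul_add, mul_smul_comm]
  left_inv x := by simp
  right_inv x := by simp

/-- The simultaneous permutation of the two standard bases of `Eⁿ ⊕ Eⁿ`. -/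
def permute (E : Type*) [CommRing E] (σ : Equiv.Perm (Fin n)) :
    SplitSpace E n ≃ₗ[E] SplitSpace E n :=
  (LinearEquiv.funCongrLeft E E σ).prodCongr (LinearEquiv.funCongrLeft E E σ)

/-- The element `τ_j` of the unitary group of `Eⁿ ⊕ Eⁿ`. -/
def splitTau (E : Type*) [CommRing E] (n j : ℕ) : SplitSpace E n ≃ₗ[E] SplitSpace E n where
  toFun x := (fun i => if (i : ℕ) < j then x.2 i else x.1 i,
    fun i => if (i : ℕ) < j then -x.1 i else x.2 i)
  invFun x := (fun i => if (i : ℕ) < j then -x.2 i else x.1 i,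
    fun i => if (i : ℕ) < j then x.1 i else x.2 i)
  map_add' x y := by
    ext i <;> by_cases h : (i : ℕ) < j <;> simp [h]; ring
  map_smul' a x := by ext i <;> by_cases h : (i : ℕ) < j <;> simp [h]
  left_inv x := by ext i <;> by_cases h : (i : ℕ) < j <;> simp [h]
  right_inv x := by ext i <;> by_cases h : (i : ℕ) < j <;> simp [h]

theorem isTau_splitTau (j : ℕ) : IsTau (splitBasis E) (splitBasis' E) j (splitTau E n j) := by
  refine ⟨fun i hi => ⟨?_, ?_⟩, fun i hi => ⟨?_, ?_⟩⟩ <;> ext k <;> by_cases hk : k = i <;>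
    simp_all [splitTau, splitBasis, splitBasis']

variable [StarRing E]

theorem isUnitary_shear {s : Fin n → E} (hs : star s = s) : IsUnitary splitForm (shear s) := by
  intro x y
  simp only [splitForm, shear, LinearEquiv.coe_mk, LinearMap.coe_mk, AddHom.coe_mk, star_add,
    star_mul', dotProduct, Pi.add_apply, Pi.mul_apply, Pi.star_apply, ← Finset.sum_sub_distrib]
  refine Finset.sum_congr rfl fun i _ => ?_
  have hi : star (s i) = s i := congrFun hs i
  rw [hi]
  ring

theorem isUnitary_permute (σ : Equiv.Perm (Fin n)) : IsUnitary splitForm (permute E σ) := by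
  intro x y
  simp only [splitForm, dotProduct, ← Finset.sum_sub_distrib]
  exact Equiv.sum_comp σ fun i => x.1 i * star y.2 i - x.2 i * star y.1 i

theorem isUnitary_splitTau (j : ℕ) : IsUnitary splitForm (splitTau E n j) := by
  intro x y
  simp only [splitForm, dotProduct, ← Finset.sum_sub_distrib]
  refine Finset.sum_congr rfl fun i _ => ?_
  by_cases h : (i : ℕ) < j <;> simp [splitTau, h]
  ring

/-- A unitary map that carries the Lagrangian `Y` into itself is parabolic, because `Y` is its own
orthogonal complement. -/
theorem isParabolic_of_apply_inr {p : SplitSpace E n ≃ₗ[E] SplitSpace E n}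
    (hu : IsUnitary splitForm p) (hp : ∀ w, (p (0, w)).1 = 0) :
    IsParabolic splitForm (splitBasis' E) p := by
  refine ⟨hu, fun y => ?_⟩
  rw [mem_span_splitBasis', mem_span_splitBasis']
  refine ⟨fun h => ?_, fun h => ?_⟩
  · ext i
    have := hu y (0, Pi.single i 1)
    simpa [splitForm, h, hp, ← Pi.single_star] using this.symm
  · rw [show y = (0, y.2) from Prod.ext h rfl, hp]

/-- An element of the unitary group that acts on `Y` by `w ↦ (c w, d w)`, with diagonal matrices
`c` and `d`, has a Bruhat decomposition as soon as a permutation `σ` moves the nonzero entries of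
`c` to the first `j` places, and `d` is a self-adjoint multiple of `c` at these entries. -/
theorem exists_isBruhat_of_perm {g : SplitSpace E n ≃ₗ[E] SplitSpace E n}
    (hu : IsUnitary splitForm g) {c d s : Fin n → E} (hg : ∀ w, g (0, w) = (c * w, d * w))
    (hs : star s = s) (hsc : ∀ i, c i ≠ 0 → s i * c i = d i) {j : ℕ} (hj : j ≤ n)
    (σ : Equiv.Perm (Fin n)) (hσ : ∀ k : Fin n, (k : ℕ) < j ↔ c (σ k) ≠ 0) :
    ∃ x : Eˣ, IsBruhat splitForm (splitBasis E) (splitBasis' E) g j x := by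
  let p₂ : SplitSpace E n ≃ₗ[E] SplitSpace E n := (permute E σ).symm ≪≫ₗ shear s
  let p₁ : SplitSpace E n ≃ₗ[E] SplitSpace E n := g ≪≫ₗ p₂.symm ≪≫ₗ (splitTau E n j).symm
  have hu₂ : IsUnitary splitForm p₂ := (isUnitary_permute σ).symm.trans (isUnitary_shear hs)
  have hp₂ : IsParabolic splitForm (splitBasis' E) p₂ := by
    refine isParabolic_of_apply_inr hu₂ fun w => ?_
    ext i
    rfl
  have hp₁ : IsParabolic splitForm (splitBasis' E) p₁ := by
    refine isParabolic_of_apply_inr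
      (hu.trans (hu₂.symm.trans (isUnitary_splitTau j).symm)) fun w => ?_
    change ((splitTau E n j).symm (permute E σ ((shear s).symm (g (0, w))))).1 = 0
    rw [hg]
    ext k
    change (if (k : ℕ) < j then -(d (σ k) * w (σ k) - s (σ k) * (c (σ k) * w (σ k)))
      else c (σ k) * w (σ k)) = 0
    split_ifs with hk
    · rw [← hsc _ ((hσ k).1 hk)]
      ring
    · rw [not_ne_iff.1 (mt (hσ k).2 hk), zero_mul]
  have hY : ∀ y ∈ Submodule.span E (Set.range (splitBasis' (n := n) E)),
      (p₁.trans p₂).toLinearMap y ∈ Submodule.span E (Set.range (splitBasis' (n := n) E)) :=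
    fun y hy => (hp₂.2 _).2 ((hp₁.2 y).2 hy)
  have hdet : IsUnit (LinearMap.det ((p₁.trans p₂).toLinearMap.restrict hY)) := by
    rw [det_restrict_eq_det_lowerBlock]
    refine IsParabolic.isUnit_det ⟨hp₁.1.trans hp₂.1, fun y => ?_⟩
    exact (hp₂.2 (p₁ y)).trans (hp₁.2 y)
  refine ⟨hdet.unit, hj, p₁, splitTau E n j, p₂, hp₁, hp₂, isTau_splitTau j, fun w => ?_, hY,
    rfl⟩
  simp [p₁]

/-- The two-dimensional case, where a suitable permutation is found by inspection. -/
theorem exists_isBruhat {g : SplitSpace E 2 ≃ₗ[E] SplitSpace E 2}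
    (hu : IsUnitary splitForm g) {c d s : Fin 2 → E} (hg : ∀ w, g (0, w) = (c * w, d * w))
    (hs : star s = s) (hsc : ∀ i, c i ≠ 0 → s i * c i = d i) :
    ∃ (j : ℕ) (x : Eˣ), IsBruhat splitForm (splitBasis E) (splitBasis' E) g j x := by
  obtain ⟨j, hj, σ, hσ⟩ : ∃ j ≤ 2, ∃ σ : Equiv.Perm (Fin 2),
      ∀ k : Fin 2, (k : ℕ) < j ↔ c (σ k) ≠ 0 := by
    by_cases h0 : c 0 = 0 <;> by_cases h1 : c 1 = 0
    · exact ⟨0, by simp, 1, by simp [Fin.forall_fin_two, h0, h1]⟩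
    · exact ⟨1, by simp, Equiv.swap 0 1, by simp [Fin.forall_fin_two, h0, h1]⟩
    · exact ⟨1, by simp, 1, by simp [Fin.forall_fin_two, h0, h1]⟩
    · exact ⟨2, le_rfl, 1, by simp [Fin.forall_fin_two, h0, h1]⟩
  exact ⟨j, exists_isBruhat_of_perm hu hg hs hsc hj σ hσ⟩

end Existence

/-! ### Transport to the doubled space -/

section Transport

variable {E : Type*} [CommRing E]

/-- Bruhat decompositions are carried along by an isomorphism under which unitary maps
correspond. The forms themselves need not correspond, so that a form that is semilinear in the first
argument may be compared with one that is semilinear in the second. -/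
theorem IsBruhat.conj {N N' : Type*} [AddCommGroup N] [Module E N] [AddCommGroup N'] [Module E N']
    {h : N → N → E} {h' : N' → N' → E} (Φ : N ≃ₗ[E] N')
    (hΦ : ∀ p : N ≃ₗ[E] N, IsUnitary h p → IsUnitary h' (Φ.symm ≪≫ₗ p ≪≫ₗ Φ))
    {n : ℕ} {e e' : Fin n → N} {g : N ≃ₗ[E] N} {j : ℕ} {x : Eˣ} (H : IsBruhat h e e' g j x) :
    IsBruhat h' (fun i => Φ (e i)) (fun i => Φ (e' i)) (Φ.symm ≪≫ₗ g ≪≫ₗ Φ) j x := by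
  have hspan : (Submodule.span E (Set.range e')).map (Φ : N →ₗ[E] N') =
      Submodule.span E (Set.range fun i => Φ (e' i)) := by
    rw [Submodule.map_span, ← Set.range_comp]
    rfl
  have hmem : ∀ y, y ∈ Submodule.span E (Set.range fun i => Φ (e' i)) ↔
      Φ.symm y ∈ Submodule.span E (Set.range e') := by
    intro y
    rw [← hspan]
    exact Submodule.mem_map_equiv (e := Φ) _
  have hpar : ∀ p, IsParabolic h e' p →
      IsParabolic h' (fun i => Φ (e' i)) (Φ.symm ≪≫ₗ p ≪≫ₗ Φ) := by
    intro p hp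
    refine ⟨hΦ p hp.1, fun y => ?_⟩
    rw [hmem, hmem]
    simpa using hp.2 (Φ.symm y)
  obtain ⟨hj, p₁, τ, p₂, hp₁, hp₂, hτ, hg, hY, hx⟩ := H
  refine ⟨hj, Φ.symm ≪≫ₗ p₁ ≪≫ₗ Φ, Φ.symm ≪≫ₗ τ ≪≫ₗ Φ, Φ.symm ≪≫ₗ p₂ ≪≫ₗ Φ, hpar _ hp₁, hpar _ hp₂,
    ⟨fun i hi => ?_, fun i hi => ?_⟩, fun w => by simp [hg], fun y hy => ?_, ?_⟩
  · simp [hτ.1 i hi]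
  · simp [hτ.2 i hi]
  · rw [hmem] at hy ⊢
    simpa using hY _ hy
  · rw [hx, ← LinearMap.det_conj _ (Φ.ofSubmodules _ _ hspan)]
    congr 1
    ext y
    simp

end Transport

section Doubling

variable {E : Type*} [CommRing E]

/-- For `2 r t = 1`, the isomorphism of the doubled space of `Eⁿ` with the split space that carries
`(-t eₖ, t eₖ)` and `(eₖ, eₖ)` to the standard bases. -/
def dblEquiv {n : ℕ} (r t : Fin n → E) (hrt : 2 * r * t = 1) :
    ((Fin n → E) × (Fin n → E)) ≃ₗ[E] SplitSpace E n where
  toFun x := (r * (x.2 - x.1), r * t * (x.1 + x.2))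
  invFun x := (x.2 - t * x.1, x.2 + t * x.1)
  map_add' x y := by ext i <;> simp <;> ring
  map_smul' a x := by ext i <;> simp <;> ring
  left_inv x := by
    refine Prod.ext ?_ ?_
    · change r * t * (x.1 + x.2) - t * (r * (x.2 - x.1)) = x.1
      linear_combination x.1 * hrt
    · change r * t * (x.1 + x.2) + t * (r * (x.2 - x.1)) = x.2
      linear_combination x.2 * hrt
  right_inv x := by
    refine Prod.ext ?_ ?_
    · change r * (x.2 + t * x.1 - (x.2 - t * x.1)) = x.1
      linear_combination x.1 * hrt
    · change r * t * (x.2 - t * x.1 + (x.2 + t * x.1)) = x.2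
      linear_combination x.2 * hrt

variable [StarRing E]

theorem splitForm_dblEquiv {n : ℕ} {r t : Fin n → E} (hrt : 2 * r * t = 1) (hr : star r = -r)
    (ht : star t = -t) (x y : (Fin n → E) × (Fin n → E)) :
    splitForm (dblEquiv r t hrt x) (dblEquiv r t hrt y) =
      dblForm (fun a b => -∑ k, r k * a k * star (b k)) x y := by
  simp only [splitForm, dotProduct, dblForm, ← Finset.sum_sub_distrib, ← Finset.sum_neg_distrib]
  refine Finset.sum_congr rfl fun k _ => ?_
  have h1 : 2 * r k * t k = 1 := congrFun hrt k
  have h2 : star (r k) = -r k := congrFun hr k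
  have h3 : star (t k) = -t k := congrFun ht k
  simp only [dblEquiv, LinearEquiv.coe_mk, LinearMap.coe_mk, AddHom.coe_mk, Pi.star_apply,
    Pi.mul_apply, Pi.add_apply, Pi.sub_apply, star_mul', star_add, star_sub, h2, h3]
  linear_combination (r k * (x.2 k * star (y.2 k) - x.1 k * star (y.1 k))) * h1

/-- The Bruhat datum of `(T, 1)` on the doubled space of a two-dimensional skew-Hermitian space `M`,
where `T` is diagonal with entries `m 0`, `m 1` of norm one in orthogonal coordinates `Ψ`: the
number `j` counts the entries `m k ≠ 1`, and `x` is the product of the corresponding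
`r k * (1 - m k)` up to norms. The twist `θ` allows forms that are semilinear in the first
argument. -/
theorem bruhatDatum_dblMap [Nontrivial E] [DecidableEq E] {M : Type*} [AddCommGroup M] [Module E M]
    (Ψ : M ≃ₗ[E] (Fin 2 → E)) {r t m : Fin 2 → E} (hrt : 2 * r * t = 1) (hr : star r = -r)
    (ht : star t = -t) (θ : E ≃+* E) {h : M → M → E}
    (hh : ∀ x y, h x y = θ (-∑ k, r k * Ψ x k * star (Ψ y k)))
    {e e' : Fin 2 → M × M} (he₁ : ∀ k, Ψ (e k).1 = Pi.single k (-t k))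
    (he₂ : ∀ k, Ψ (e k).2 = Pi.single k (t k)) (he₁' : ∀ k, Ψ (e' k).1 = Pi.single k 1)
    (he₂' : ∀ k, Ψ (e' k).2 = Pi.single k 1)
    {T : M ≃ₗ[E] M} (hT : ∀ x, Ψ (T x) = m * Ψ x) (hm : m * star m = 1)
    (hm1 : ∀ k, m k = 1 ∨ IsUnit (1 - m k)) :
    (bruhatDatum (dblForm h) e e' (dblMap T)).1 =
        (if m 0 = 1 then 0 else 1) + (if m 1 = 1 then 0 else 1) ∧
      ∃ z : E, ((bruhatDatum (dblForm h) e e' (dblMap T)).2 : E) =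
        (if m 0 = 1 then 1 else r 0 * (1 - m 0)) * (if m 1 = 1 then 1 else r 1 * (1 - m 1)) *
          (z * star z) := by
  have hm' : ∀ k, m k * star (m k) = 1 := fun k => congrFun hm k
  have hrt' : ∀ k, 2 * r k * t k = 1 := fun k => congrFun hrt k
  have ht' : ∀ k, star (t k) = -t k := fun k => congrFun ht k
  have hru : ∀ k, IsUnit (r k) := fun k =>
    IsUnit.of_mul_eq_one (2 * t k) (by linear_combination hrt' k)
  let Φ : (M × M) ≃ₗ[E] SplitSpace E 2 := Ψ.prodCongr Ψ ≪≫ₗ dblEquiv r t hrt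
  have hform : ∀ x y, dblForm h x y = θ (splitForm (Φ x) (Φ y)) := by
    intro x y
    change h _ _ - h _ _ = θ (splitForm (dblEquiv r t hrt _) (dblEquiv r t hrt _))
    rw [splitForm_dblEquiv hrt hr ht, hh, hh, ← map_sub]
    rfl
  have hΦ : ∀ p : (M × M) ≃ₗ[E] (M × M), IsUnitary (dblForm h) p →
      IsUnitary splitForm (Φ.symm ≪≫ₗ p ≪≫ₗ Φ) := by
    intro p hp x y
    apply θ.injective
    have := hp (Φ.symm x) (Φ.symm y)
    rw [hform, hform] at this
    simpa using this
  have hΦ' : ∀ p : SplitSpace E 2 ≃ₗ[E] SplitSpace E 2, IsUnitary splitForm p →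
      IsUnitary (dblForm h) (Φ.symm.symm ≪≫ₗ p ≪≫ₗ Φ.symm) := by
    intro p hp x y
    rw [hform, hform]
    simpa using congrArg θ (hp (Φ x) (Φ y))
  have hΦe : (fun k => Φ (e k)) = splitBasis E := by
    funext k
    refine Prod.ext ?_ ?_
    · change r * (Ψ (e k).2 - Ψ (e k).1) = Pi.single k 1
      rw [he₁, he₂]
      ext i
      by_cases hi : i = k
      · subst hi
        simp only [Pi.mul_apply, Pi.sub_apply, Pi.single_eq_same]
        linear_combination hrt' i
      · simp [hi]
    · change r * t * (Ψ (e k).1 + Ψ (e k).2) = 0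
      rw [he₁, he₂, ← Pi.single_add]
      simp
  have hΦe' : (fun k => Φ (e' k)) = splitBasis' E := by
    funext k
    refine Prod.ext ?_ ?_
    · change r * (Ψ (e' k).2 - Ψ (e' k).1) = 0
      rw [he₁', he₂', sub_self, mul_zero]
    · change r * t * (Ψ (e' k).1 + Ψ (e' k).2) = Pi.single k 1
      rw [he₁', he₂']
      ext i
      by_cases hi : i = k
      · subst hi
        simp only [Pi.mul_apply, Pi.add_apply, Pi.single_eq_same]
        linear_combination hrt' i
      · simp [hi]
  have he : e = fun k => Φ.symm (splitBasis E k) := by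
    funext k
    rw [← hΦe, Φ.symm_apply_apply]
  have he' : e' = fun k => Φ.symm (splitBasis' E k) := by
    funext k
    rw [← hΦe', Φ.symm_apply_apply]
  have hTu : IsUnitary (dblForm h) (dblMap T) := by
    intro x y
    change h (T x.1) (T y.1) - h x.2 y.2 = h x.1 y.1 - h x.2 y.2
    rw [hh (T x.1), hh x.1, hT, hT]
    congr 3
    refine Finset.sum_congr rfl fun k _ => ?_
    simp only [Pi.mul_apply, star_mul']
    linear_combination (r k * Ψ x.1 k * star (Ψ y.1 k)) * hm' k
  set g := Φ.symm ≪≫ₗ dblMap T ≪≫ₗ Φ with hg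
  have hgw : ∀ w, g (0, w) = ((fun k => r k * (1 - m k)) * w,
      (fun k => r k * t k * (1 + m k)) * w) := by
    intro w
    have h1 : Φ.symm (0, w) = (Ψ.symm w, Ψ.symm w) := by
      rw [Φ.symm_apply_eq]
      refine Prod.ext ?_ ?_
      · change 0 = r * (Ψ (Ψ.symm w) - Ψ (Ψ.symm w))
        rw [sub_self, mul_zero]
      · change w = r * t * (Ψ (Ψ.symm w) + Ψ (Ψ.symm w))
        rw [Ψ.apply_symm_apply]
        linear_combination -w * hrt
    change Φ (dblMap T (Φ.symm (0, w))) = _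
    rw [h1]
    change (r * (Ψ (Ψ.symm w) - Ψ (T (Ψ.symm w))), r * t * (Ψ (T (Ψ.symm w)) + Ψ (Ψ.symm w))) = _
    rw [hT, Ψ.apply_symm_apply]
    ext k
    · simp only [Pi.mul_apply, Pi.sub_apply]
      ring
    · simp only [Pi.mul_apply, Pi.add_apply]
      ring
  have hc0 : ∀ k, r k * (1 - m k) = 0 ↔ m k = 1 := fun k => by
    rw [(hru k).mul_right_eq_zero, sub_eq_zero, eq_comm]
  have hc : ∀ k, r k * (1 - m k) = 0 ∨ IsUnit (r k * (1 - m k)) := fun k =>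
    (hm1 k).imp (hc0 k).2 (hru k).mul
  -- The multiplier is `d / c = t (1 + m) / (1 - m)`, which is self-adjoint as `star m = m⁻¹`.
  have hs : ∀ k, ∃ s : E, star s = s ∧
      (r k * (1 - m k) ≠ 0 → s * (r k * (1 - m k)) = r k * t k * (1 + m k)) := by
    intro k
    rcases hm1 k with hk | hk
    · exact ⟨0, star_zero _, fun h => absurd ((hc0 k).2 hk) h⟩
    · obtain ⟨w, hw⟩ := hk.exists_right_inv
      have hw' : (1 - star (m k)) * star w = 1 := by
        rw [← star_one E, ← star_sub, ← star_mul', hw]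
      have hsw : star w = -(m k * w) := by
        linear_combination -(star w) * hw - (m k * w) * hw' - (w * star w) * hm' k
      refine ⟨t k * (1 + m k) * w, ?_, fun _ => ?_⟩
      · rw [star_mul', star_mul', star_add, star_one, ht', hsw]
        linear_combination (t k * w) * hm' k
      · linear_combination (r k * t k * (1 + m k)) * hw
  choose s hs hsc using hs
  obtain ⟨j, x, H⟩ := exists_isBruhat (hΦ _ hTu) hgw (funext hs) hsc
  have H' : ∃ d : ℕ × Eˣ, IsBruhat (dblForm h) e e' (dblMap T) d.1 d.2 := by
    refine ⟨(j, x), ?_⟩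
    have := H.conj Φ.symm hΦ'
    rw [← he, ← he'] at this
    convert this using 1
    ext w <;> simp
  have hd := H'.choose_spec.conj Φ hΦ
  rw [hΦe, hΦe'] at hd
  have hfin := hd.eq_card_and_eq_prod hgw hc fun k hk => by
    rw [(hc0 k).1 hk]
    linear_combination hrt' k
  simp only [hc0] at hfin
  rw [bruhatDatum, dif_pos H']
  exact hfin

end Doubling

/-! ### The quadratic algebra `E` -/

section QuadraticAlgebra

variable {F : Type*} [Field F] {u : F}

theorem QE.re_one : (1 : QE u).re = 1 := rfl

theorem QE.im_one : (1 : QE u).im = 0 := rfl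

theorem QE.two_eq : (2 : QE u) = ⟨2, 0⟩ := (map_ofNat (algebraMap F (QE u)) 2).symm

/-- This holds also for split `E`, where `1 - m` could a priori be a zero divisor: a
norm-one `m` with `Nm (1 - m) = 0` has trace `2`, and so equals `1`. -/
theorem eq_one_or_isUnit_one_sub (h2 : (2 : F) ≠ 0) (hu : u ≠ 0) {m : QE u} (hm : m * star m = 1) :
    m = 1 ∨ IsUnit (1 - m) := by
  rw [QuadraticAlgebra.isUnit_iff_norm_isUnit, isUnit_iff_ne_zero, or_iff_not_imp_right, not_ne_iff]
  intro h
  have h1 : m.re * m.re - u * m.im * m.im = 1 := by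
    have := congrArg QuadraticAlgebra.re hm
    simp [QE.re_one] at this
    linear_combination this
  have h3 : (1 - m.re) * (1 - m.re) - u * m.im * m.im = 0 := by
    rw [QuadraticAlgebra.norm_def] at h
    simp [QE.re_one, QE.im_one] at h
    linear_combination h
  have hre : m.re = 1 := mul_left_cancel₀ h2 (by linear_combination h1 - h3)
  have him : m.im = 0 := by
    rw [hre] at h3
    simpa [hu] using h3
  exact QuadraticAlgebra.ext hre him

theorem hilbertSymbol_norm (z : QE u) : hilbertSymbol (QuadraticAlgebra.norm z) u = 1 := by
  refine if_pos ⟨1, z.im, z.re, by simp, ?_⟩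
  rw [QuadraticAlgebra.norm_def]
  ring

/-- A character of `Eˣ` that restricts to `(·, u)_F` on `Fˣ` is trivial on norms, so its value at
`f Nm(z)` is `(f, u)_F`. -/
theorem char_mul_char_eq_hilbertSymbol {ξ : (QE u)ˣ →* Circle}
    (hξ : ∀ a : Fˣ,
      (ξ (Units.map (algebraMap F (QE u)).toMonoidHom a) : ℂ) = (hilbertSymbol (a : F) u : ℂ))
    {x y : (QE u)ˣ} {f : F} {z : QE u}
    (h : (x : QE u) * y = algebraMap F (QE u) f * (z * star z)) :
    (ξ x : ℂ) * ξ y = hilbertSymbol f u := by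
  have hf : f ≠ 0 := by
    rintro rfl
    rw [map_zero, zero_mul] at h
    exact (x * y).ne_zero h
  have hz : QuadraticAlgebra.norm z ≠ 0 := by
    intro hz
    rw [← QuadraticAlgebra.algebraMap_norm_eq_mul_star, hz, map_zero, mul_zero] at h
    exact (x * y).ne_zero h
  have hxy : x * y = Units.map (algebraMap F (QE u)).toMonoidHom (Units.mk0 f hf) *
      Units.map (algebraMap F (QE u)).toMonoidHom (Units.mk0 _ hz) := by
    ext1
    rw [Units.val_mul, h, ← QuadraticAlgebra.algebraMap_norm_eq_mul_star]
    rfl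
  rw [← Circle.coe_mul, ← map_mul, hxy, map_mul, Circle.coe_mul, hξ, hξ, Units.val_mk0,
    Units.val_mk0, hilbertSymbol_norm]
  simp

/-- Up to norms, the values of `x` on the two sides, for `w = a⁻¹`, are `f / a` and `f / b̄` with the
same `f` in `F`. If neither plane is trivial, then `f = -2 u J (re a - re b)`. -/
theorem exists_algebraMap_eq [DecidableEq F] (h2 : (2 : F) ≠ 0) (J : F) {a w b : QE u}
    (hw : a * w = 1)
    (hab : a * star a = b * star b) :
    ∃ f : F,
      (if w * b = 1 then 1 else iE u * (1 - w * b)) *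
          (if w * star b = 1 then 1
            else -(algebraMap F (QE u) J * iE u) * (1 - w * star b)) * a =
        algebraMap F (QE u) f ∧
      (if w * b = 1 then 1 else iE u * (1 - w * b)) *
          (if star w * b = 1 then 1
            else algebraMap F (QE u) J * iE u * (1 - star w * b)) * star b =
        algebraMap F (QE u) f := by
  have hw' : star a * star w = 1 := by rw [← star_mul', hw, star_one]
  have hi : iE u * iE u = algebraMap F (QE u) u := by ext <;> simp [iE]
  have hia : iE u * (a - star a) = algebraMap F (QE u) (2 * u * a.im) := by
    ext <;> simp [iE]
    ring
  have hta : a + star a = algebraMap F (QE u) (2 * a.re) := by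
    ext <;> simp
    ring
  have htb : b + star b = algebraMap F (QE u) (2 * b.re) := by
    ext <;> simp
    ring
  have e1 : w * b = 1 ↔ b = a := by
    constructor <;> intro h
    · linear_combination a * h - b * hw
    · rw [h, mul_comm, hw]
  have e2 : w * star b = 1 ↔ star b = a := by
    constructor <;> intro h
    · linear_combination a * h - star b * hw
    · rw [h, mul_comm, hw]
  have e3 : star w * b = 1 ↔ star b = a := by
    rw [← e2, ← star_inj, star_mul', star_star, star_one]
  simp only [e1, e2, e3]
  by_cases h1 : b = a <;> by_cases hb : star b = a
  · rw [if_pos h1, if_pos hb, if_pos hb, hb]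
    have him : a.im = 0 := by
      have := congrArg QuadraticAlgebra.im hb
      rw [h1] at this
      simp only [QuadraticAlgebra.im_star] at this
      exact mul_left_cancel₀ h2 (by linear_combination -this)
    refine ⟨a.re, ?_, ?_⟩ <;> ext <;> simp [him]
  · refine ⟨-(J * (2 * u * a.im)), ?_, ?_⟩ <;>
      rw [if_pos h1, if_neg hb, h1, map_neg, map_mul, ← hia]
    · linear_combination (algebraMap F (QE u) J * iE u * star a) * hw
    · linear_combination (-algebraMap F (QE u) J * iE u * a) * hw'
  · have hb' : b = star a := by rw [← hb, star_star]
    refine ⟨2 * u * a.im, ?_, ?_⟩ <;>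
      rw [if_neg h1, if_pos hb, ← hia]
    · rw [hb']
      linear_combination (-iE u * star a) * hw
    · rw [hb, hb']
      linear_combination (-iE u * star a) * hw
  · refine ⟨-(J * u * (2 * a.re - 2 * b.re)), ?_, ?_⟩ <;>
      rw [if_neg h1, if_neg hb, map_neg, map_mul, map_mul, map_sub, ← hta, ← htb, ← hi]
    · linear_combination (-(algebraMap F (QE u) J) * iE u * iE u) *
        ((-(b + star b) + w * b * star b + star a) * hw - w * hab)
    · linear_combination (algebraMap F (QE u) J * iE u * iE u) *
        (-star a * hw - a * hw' + (w + star w) * hab +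
          b * (star a * star w * hw + hw' - w * star w * hab))

end QuadraticAlgebra

/-! ### The spaces `W₀` and `Res V` in coordinates -/

section Spaces

variable {F : Type*} [Field F] (u J : F)

/-- The coordinates of `W₀ = E ⊕ E𝐣` as a left `E`-space. -/
def W0.coord : W0 u J ≃ₗ[QE u] (Fin 2 → QE u) where
  toFun x := ![⟨(W0.toB u J x).re, (W0.toB u J x).imI⟩, ⟨(W0.toB u J x).imJ, (W0.toB u J x).imK⟩]
  invFun a := (W0.toB u J).symm ⟨(a 0).re, (a 0).im, (a 1).re, (a 1).im⟩
  map_add' x y := by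
    ext k <;> fin_cases k <;> simp
  map_smul' a x := by
    have h : W0.toB u J (a • x) = emb u J a * W0.toB u J x := rfl
    ext k <;> fin_cases k <;> simp [h, emb]
  left_inv x := rfl
  right_inv a := by
    ext k <;> fin_cases k <;> rfl

/-- The coordinates of `Res V = E ⊕ 𝐣E` as a right `E`-space. -/
def ResV.coord : ResV u J ≃ₗ[QE u] (Fin 2 → QE u) where
  toFun x := ![⟨(ResV.toB u J x).re, (ResV.toB u J x).imI⟩,
    ⟨(ResV.toB u J x).imJ, -(ResV.toB u J x).imK⟩]
  invFun a := (ResV.toB u J).symm ⟨(a 0).re, (a 0).im, (a 1).re, -(a 1).im⟩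
  map_add' x y := by
    ext k <;> fin_cases k <;> simp
    ring
  map_smul' a x := by
    have h : ResV.toB u J (a • x) = ResV.toB u J x * emb u J a := rfl
    ext k <;> fin_cases k <;> simp [h, emb]
    all_goals ring
  left_inv x := by
    apply (ResV.toB u J).injective
    ext <;> simp
  right_inv a := by
    ext k <;> fin_cases k <;> simp

variable {u J}

@[simp]
theorem W0.coord_zero (x : W0 u J) :
    W0.coord u J x 0 = ⟨(W0.toB u J x).re, (W0.toB u J x).imI⟩ := rfl

@[simp]
theorem W0.coord_one (x : W0 u J) :
    W0.coord u J x 1 = ⟨(W0.toB u J x).imJ, (W0.toB u J x).imK⟩ := rfl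

@[simp]
theorem ResV.coord_zero (x : ResV u J) :
    ResV.coord u J x 0 = ⟨(ResV.toB u J x).re, (ResV.toB u J x).imI⟩ := rfl

@[simp]
theorem ResV.coord_one (x : ResV u J) :
    ResV.coord u J x 1 = ⟨(ResV.toB u J x).imJ, -(ResV.toB u J x).imK⟩ := rfl

theorem i0_torus0_apply (α β : (QE u)ˣ) (h : normU u α = normU u β) (x : W0 u J × W0 u J) :
    i0 u J (torus0 u J α β h) x =
      ((W0.toB u J).symm (emb u J ↑α⁻¹ * (W0.toB u J x.1 * emb u J β)), x.2) := by
  refine Prod.ext ?_ rfl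
  change TensorProduct.lid (QE u) (W0 u J) (TensorProduct.congr
    (LinearEquiv.smulOfUnit α : QE u ≃ₗ[QE u] QE u).symm (rmulW0 u J β)
      ((TensorProduct.lid (QE u) (W0 u J)).symm x.1)) = _
  rw [TensorProduct.lid_symm_apply, TensorProduct.congr_tmul, TensorProduct.lid_tmul]
  have h1 : (LinearEquiv.smulOfUnit α : QE u ≃ₗ[QE u] QE u).symm 1 = ↑α⁻¹ := mul_one _
  rw [h1]
  rfl

theorem i1_torus1_apply (α β : (QE u)ˣ) (h : normU u α = normU u β) (x : ResV u J × ResV u J) :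
    i1 u J (torus1 u J α β h) x =
      ((ResV.toB u J).symm (emb u J ↑α⁻¹ * (ResV.toB u J x.1 * emb u J β)), x.2) := by
  refine Prod.ext ?_ rfl
  change TensorProduct.rid (QE u) (ResV u J) (TensorProduct.congr
    (lmulResV u J α).symm (LinearEquiv.smulOfUnit β : QE u ≃ₗ[QE u] QE u)
      ((TensorProduct.rid (QE u) (ResV u J)).symm x.1)) = _
  rw [TensorProduct.rid_symm_apply, TensorProduct.congr_tmul, TensorProduct.rid_tmul]
  have h1 : (LinearEquiv.smulOfUnit β : QE u ≃ₗ[QE u] QE u) 1 = β := mul_one _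
  rw [h1]
  exact mul_assoc (emb u J ↑α⁻¹) (ResV.toB u J x.1) (emb u J β)

/-- Both embeddings send `(α, β)` to `x ↦ α⁻¹ x β` on the first summand of `𝕍^□`, so that the
functions `λ` agree. -/
theorem iota0_i0_torus0 (α β : (QE u)ˣ) (h : normU u α = normU u β) :
    iota0 u J (i0 u J (torus0 u J α β h)) = iota1 u J (i1 u J (torus1 u J α β h)) := by
  refine LinearEquiv.ext fun x => ?_
  have h0 := i0_torus0_apply (J := J) α β h x
  have h1 := i1_torus1_apply (J := J) α β h x
  exact h0.trans h1.symm

end Spaces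

/-! ### Values of the splittings -/

section Values

variable {F : Type*} [Field F] {u J : F}

theorem hW0_eq (x y : W0 u J) :
    hW0 u J x y = -∑ k, ![iE u, -(algebraMap F (QE u) J * iE u)] k * W0.coord u J x k *
      star (W0.coord u J y k) := by
  rw [Fin.sum_univ_two]
  ext <;> simp [hW0, pr, iE] <;> ring

/-- The form of `Res V` is semilinear in the first argument; the involution of `E` turns it into one
that is semilinear in the second. -/
theorem hResV_eq (x y : ResV u J) :
    hResV u J x y = starRingAut (-∑ k, ![iE u, algebraMap F (QE u) J * iE u] k *
      ResV.coord u J x k * star (ResV.coord u J y k)) := by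
  rw [Fin.sum_univ_two]
  ext <;> simp [hResV, pr, iE, emb] <;> ring

theorem coe_mul_star_eq {α β : (QE u)ˣ} (h : normU u α = normU u β) :
    (α : QE u) * star (α : QE u) = β * star (β : QE u) := by
  rw [← QuadraticAlgebra.algebraMap_norm_eq_mul_star,
    ← QuadraticAlgebra.algebraMap_norm_eq_mul_star]
  exact congrArg (algebraMap F (QE u)) (congrArg Units.val h)

theorem mul_star_eq_one {a w b : QE u} (hw : a * w = 1) (hab : a * star a = b * star b) :
    w * b * star (w * b) = 1 := by
  have hw' : star a * star w = 1 := by rw [← star_mul', hw, star_one]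
  rw [star_mul']
  linear_combination (-w * star w) * hab + (star a * star w) * hw + hw'

/-- The image of `(α, β)` in `U(W₀^□)` is diagonal with entries `α⁻¹ β`, `α⁻¹ β̄` on
`W₀ = E ⊕ E𝐣`, because `𝐣 β = β̄ 𝐣`. -/
theorem bruhatDatum_i0 [DecidableEq F] (h2 : (2 : F) ≠ 0) (hu : u ≠ 0) (hJ : J ≠ 0) (α β : (QE u)ˣ)
    (h : normU u α = normU u β) :
    (bruhatDatum (dblForm (hW0 u J))
        (fun k => ((W0.toB u J).prodCongr (W0.toB u J)).symm (wittV u J k))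
        (fun k => ((W0.toB u J).prodCongr (W0.toB u J)).symm (wittV' u J k))
        (i0 u J (torus0 u J α β h))).1 =
      (if (↑α⁻¹ * β : QE u) = 1 then 0 else 1) +
        (if (↑α⁻¹ * star (β : QE u) : QE u) = 1 then 0 else 1) ∧
    ∃ z : QE u, ((bruhatDatum (dblForm (hW0 u J))
        (fun k => ((W0.toB u J).prodCongr (W0.toB u J)).symm (wittV u J k))
        (fun k => ((W0.toB u J).prodCongr (W0.toB u J)).symm (wittV' u J k))
        (i0 u J (torus0 u J α β h))).2 : QE u) =
      (if (↑α⁻¹ * β : QE u) = 1 then 1 else iE u * (1 - ↑α⁻¹ * β)) *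
        (if (↑α⁻¹ * star (β : QE u) : QE u) = 1 then 1
          else -(algebraMap F (QE u) J * iE u) * (1 - ↑α⁻¹ * star (β : QE u))) * (z * star z) := by
  have hab := coe_mul_star_eq h
  have hm0 := mul_star_eq_one α.mul_inv hab
  have hm1 := mul_star_eq_one (b := star (β : QE u)) α.mul_inv (by rw [hab, star_star, mul_comm])
  refine bruhatDatum_dblMap (W0.coord u J)
    (r := ![iE u, -(algebraMap F (QE u) J * iE u)])
    (t := ![(2 * u)⁻¹ • iE u, -((2 * u * J)⁻¹ • iE u)])
    (m := ![↑α⁻¹ * β, ↑α⁻¹ * star (β : QE u)])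
    ?_ ?_ ?_ (RingEquiv.refl (QE u)) hW0_eq ?_ ?_ ?_ ?_ ?_ ?_ ?_
  · ext k <;> fin_cases k <;> simp [iE, QE.two_eq, QE.re_one, QE.im_one]
    all_goals field_simp
  · ext k <;> fin_cases k <;> simp [iE]
  · ext k <;> fin_cases k <;> simp [iE]
  · intro k
    ext i <;> fin_cases k <;> fin_cases i <;> simp [wittV, iE, emb, jB]
  · intro k
    ext i <;> fin_cases k <;> fin_cases i <;> simp [wittV, iE, emb, jB]
  · intro k
    ext i <;> fin_cases k <;> fin_cases i <;> simp [wittV', jB, QE.re_one, QE.im_one]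
  · intro k
    ext i <;> fin_cases k <;> fin_cases i <;> simp [wittV', jB, QE.re_one, QE.im_one]
  · intro x
    have hx := congrArg Prod.fst (i0_torus0_apply (J := J) α β h (x, 0))
    change W0.coord u J (i0 u J (torus0 u J α β h) (x, 0)).1 = _
    rw [hx]
    ext i <;> fin_cases i <;> simp [emb] <;> ring
  · ext1 k
    fin_cases k
    · exact hm0
    · exact hm1
  · intro k
    fin_cases k
    · exact eq_one_or_isUnit_one_sub h2 hu hm0
    · exact eq_one_or_isUnit_one_sub h2 hu hm1

/-- The image of `(α, β)` in `U(Res V^□)` is diagonal with entries `α⁻¹ β`, `ᾱ⁻¹ β` on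
`Res V = E ⊕ 𝐣E`, because `α⁻¹ 𝐣 = 𝐣 ᾱ⁻¹`. -/
theorem bruhatDatum_i1 [DecidableEq F] (h2 : (2 : F) ≠ 0) (hu : u ≠ 0) (hJ : J ≠ 0) (α β : (QE u)ˣ)
    (h : normU u α = normU u β) :
    (bruhatDatum (dblForm (hResV u J))
        (fun k => ((ResV.toB u J).prodCongr (ResV.toB u J)).symm (wittV u J k))
        (fun k => ((ResV.toB u J).prodCongr (ResV.toB u J)).symm (wittV' u J k))
        (i1 u J (torus1 u J α β h))).1 =
      (if (↑α⁻¹ * β : QE u) = 1 then 0 else 1) +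
        (if (star (↑α⁻¹ : QE u) * β) = 1 then 0 else 1) ∧
    ∃ z : QE u, ((bruhatDatum (dblForm (hResV u J))
        (fun k => ((ResV.toB u J).prodCongr (ResV.toB u J)).symm (wittV u J k))
        (fun k => ((ResV.toB u J).prodCongr (ResV.toB u J)).symm (wittV' u J k))
        (i1 u J (torus1 u J α β h))).2 : QE u) =
      (if (↑α⁻¹ * β : QE u) = 1 then 1 else iE u * (1 - ↑α⁻¹ * β)) *
        (if (star (↑α⁻¹ : QE u) * β) = 1 then 1
          else algebraMap F (QE u) J * iE u * (1 - star (↑α⁻¹ : QE u) * β)) * (z * star z) := by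
  have hab := coe_mul_star_eq h
  have hm0 := mul_star_eq_one α.mul_inv hab
  have hm1 := mul_star_eq_one (a := star (α : QE u)) (w := star (↑α⁻¹ : QE u)) (b := β)
    (by rw [← star_mul', α.mul_inv, star_one]) (by rw [star_star, mul_comm, hab])
  refine bruhatDatum_dblMap (ResV.coord u J)
    (r := ![iE u, algebraMap F (QE u) J * iE u])
    (t := ![(2 * u)⁻¹ • iE u, (2 * u * J)⁻¹ • iE u])
    (m := ![↑α⁻¹ * β, star (↑α⁻¹ : QE u) * β])
    ?_ ?_ ?_ (starRingAut) hResV_eq ?_ ?_ ?_ ?_ ?_ ?_ ?_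
  · ext k <;> fin_cases k <;> simp [iE, QE.two_eq, QE.re_one, QE.im_one]
    all_goals field_simp
  · ext k <;> fin_cases k <;> simp [iE]
  · ext k <;> fin_cases k <;> simp [iE]
  · intro k
    ext i <;> fin_cases k <;> fin_cases i <;> simp [wittV, iE, emb, jB]
  · intro k
    ext i <;> fin_cases k <;> fin_cases i <;> simp [wittV, iE, emb, jB]
  · intro k
    ext i <;> fin_cases k <;> fin_cases i <;> simp [wittV', jB, QE.re_one, QE.im_one]
  · intro k
    ext i <;> fin_cases k <;> fin_cases i <;> simp [wittV', jB, QE.re_one, QE.im_one]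
  · intro x
    have hx := congrArg Prod.fst (i1_torus1_apply (J := J) α β h (x, 0))
    change ResV.coord u J (i1 u J (torus1 u J α β h) (x, 0)).1 = _
    rw [hx]
    ext i <;> fin_cases i <;> simp [emb] <;> ring
  · ext1 k
    fin_cases k
    · exact hm0
    · exact hm1
  · intro k
    fin_cases k
    · exact eq_one_or_isUnit_one_sub h2 hu hm0
    · exact eq_one_or_isUnit_one_sub h2 hu hm1

end Values

end KudlaSplitting

theorem propositionp {F : Type*} [NontriviallyNormedField F] [LocallyCompactSpace F] [CharZero F]
    (ψ : AddChar F Circle) (hψ : Continuous ψ) (hψ1 : ψ ≠ 1)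
    (u J : F) (hu : u ≠ 0) (hJ : J ≠ 0)
    (X Y : Submodule F (QB u J)) (hXY : IsPolarization u J X Y)
    (ξ ξ' : (QE u)ˣ →* Circle)
    (hξ : ∀ a : Fˣ,
      (ξ (Units.map (algebraMap F (QE u)).toMonoidHom a) : ℂ) = (hilbertSymbol (a : F) u : ℂ))
    (hξ' : ∀ a : Fˣ,
      (ξ' (Units.map (algebraMap F (QE u)).toMonoidHom a) : ℂ) = (hilbertSymbol (a : F) u : ℂ))
    (α β : (QE u)ˣ)
    (hαβ : normU u α = normU u β) :
    s1 u J ψ ξ' Y (torus1 u J α β hαβ) =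
      (ξ α : ℂ) * (ξ' β : ℂ) * s0 u J ψ ξ Y (torus0 u J α β hαβ) := by
  classical
  have h2 : (2 : F) ≠ 0 := two_ne_zero
  obtain ⟨hj₀, z₀, hz₀⟩ := bruhatDatum_i0 (J := J) h2 hu hJ α β hαβ
  obtain ⟨hj₁, z₁, hz₁⟩ := bruhatDatum_i1 (J := J) h2 hu hJ α β hαβ
  obtain ⟨f, hf₀, hf₁⟩ := exists_algebraMap_eq h2 J α.mul_inv (coe_mul_star_eq hαβ)
  -- The nontrivial planes are the same on both sides: `α⁻¹ β̄ = 1` if and only if `ᾱ⁻¹ β = 1`.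
  have hj : (↑α⁻¹ * star (β : QE u) : QE u) = 1 ↔ star (↑α⁻¹ : QE u) * β = 1 := by
    rw [← star_inj, star_mul', star_star, star_one]
  simp only [hj] at hj₀
  rw [s0, s1, iota0_i0_torus0, beta0, beta1, kudla, kudla, hj₀, hj₁]
  set x₀ := (bruhatDatum (dblForm (hW0 u J))
    (fun k => ((W0.toB u J).prodCongr (W0.toB u J)).symm (wittV u J k))
    (fun k => ((W0.toB u J).prodCongr (W0.toB u J)).symm (wittV' u J k))
    (i0 u J (torus0 u J α β hαβ))).2
  set x₁ := (bruhatDatum (dblForm (hResV u J))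
    (fun k => ((ResV.toB u J).prodCongr (ResV.toB u J)).symm (wittV u J k))
    (fun k => ((ResV.toB u J).prodCongr (ResV.toB u J)).symm (wittV' u J k))
    (i1 u J (torus1 u J α β hαβ))).2
  have h₀ : (ξ x₀ : ℂ) * ξ α = hilbertSymbol f u :=
    char_mul_char_eq_hilbertSymbol hξ (z := z₀) (by rw [hz₀, ← hf₀]; ring)
  have h₁ : (ξ' x₁ : ℂ) * ξ' (star β) = hilbertSymbol f u :=
    char_mul_char_eq_hilbertSymbol hξ' (z := z₁) (by rw [hz₁, ← hf₁, Units.coe_star]; ring)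
  have hβ : (ξ' (star β) : ℂ) * ξ' β = hilbertSymbol (1 : F) u :=
    char_mul_char_eq_hilbertSymbol hξ' (z := (β : QE u)) (by
      rw [map_one, Units.coe_star]; ring)
  have hone : hilbertSymbol (1 : F) u = 1 := by
    rw [← hilbertSymbol_norm (1 : QE u), map_one]
  rw [hone, Int.cast_one] at hβ
  have hx : (ξ' x₁ : ℂ) = ξ α * ξ' β * ξ x₀ := by
    linear_combination (ξ' β : ℂ) * (h₁ - h₀) - (ξ' x₁ : ℂ) * hβ
  rw [hx]
  ring
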